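/- Let $k$ be a field of characteristic $p>0$ with $[k:k^p]<\infty$, let $S=k[x_0,\dots,x_n]$ with its standard grading, and let $\mathfrak m=(x_0,\dots,x_n)$. Let $f_1,\dots,f_c\in S$ be homogeneous polynomials forming a regular sequence, and put $J=(f_1,\dots,f_c)$, $R=S/J$ and $d=\sum_{j=1}^c\deg(f_j)$. Let $\mathrm{Jac}(R)\subseteq S$ be the ideal generated by the $c\times c$ minors of the Jacobian matrix $(\partial f_j/\partial x_i)$, $0\le i\le n$, $1\le j\le c$. Suppose that $\sqrt{\mathrm{Jac}(R)+J}=\mathfrak m$ and that $p\ge (n+1-c)(d-c)$. Then the Frobenius action $F$ on the $\mathbb Z$-graded local cohomology module $H^{n+1-c}_{\mathfrak m}(R)$ (the map induced by the Frobenius endomorphism of $R$, which may be computed on the Čech complex of $x_0,\dots,x_n$) maps the part of negative degree into itself, and $$F: H^{n+1-c}_{\mathfrak m}(R)_{<0}\longrightarrow H^{n+1-c}_{\mathfrak m}(R)_{<0}$$ is injective. -/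

import Mathlib

noncomputable section

/-! ### Frobenius on rings in which a prime `p` vanishes (possibly the zero ring) -/

/-- The Frobenius endomorphism `z ↦ z ^ p` of a commutative ring `B` with `p = 0` in `B`. -/
def frobHom {B : Type*} [CommRing B] (p : ℕ) [hp : Fact p.Prime] (h : (p : B) = 0) : B →+* B where
  toFun z := z ^ p
  map_one' := one_pow p
  map_mul' a b := mul_pow a b p
  map_zero' := zero_pow hp.out.ne_zero
  map_add' a b := by
    obtain ⟨r, hr⟩ := exists_add_pow_prime_eq hp.out a b
    rw [hr, h]
    ring

/-! ### Local cohomology through the Čech complex -/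

namespace Cech

variable {A : Type*} [CommRing A] {ι : Type*}

/-- The localization of `A` at the product of the `x i`, `i ∈ T`. -/
abbrev Loc (x : ι → A) (T : Finset ι) : Type _ :=
  Localization.Away (∏ i ∈ T, x i)

theorem isUnit_prod (x : ι → A) {T U : Finset ι} (h : T ⊆ U) :
    IsUnit (Algebra.ofId A (Loc x U) (∏ i ∈ T, x i)) :=
  IsLocalization.Away.isUnit_of_dvd (S := Loc x U) (∏ i ∈ U, x i)
    (Finset.prod_dvd_prod_of_subset T U x h)

/-- The canonical localization map `A_{x_T} → A_{x_U}` for `T ⊆ U`. -/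
def res (x : ι → A) {T U : Finset ι} (h : T ⊆ U) : Loc x T →ₐ[A] Loc x U :=
  IsLocalization.Away.liftAlgHom (∏ i ∈ T, x i) (f := Algebra.ofId A (Loc x U)) (isUnit_prod x h)

theorem res_res (x : ι → A) {T U V : Finset ι} (h : T ⊆ U) (h' : U ⊆ V) (z : Loc x T) :
    res x h' (res x h z) = res x (h.trans h') z := by
  have : (res x h').comp (res x h) = res x (h.trans h') :=
    (IsLocalization.algHom_subsingleton (Submonoid.powers (∏ i ∈ T, x i))).elim _ _
  exact DFunLike.congr_fun this z

theorem natCast_loc (x : ι → A) {p : ℕ} (h : (p : A) = 0) (T : Finset ι) :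
    (p : Loc x T) = 0 := by
  rw [← map_natCast (algebraMap A (Loc x T)), h, map_zero]

/-- Čech cochains of degree `q`: the product of the localizations `A_{x_T}` over all `q`-element
subsets `T` of the index set. In degree `0` this is `A` itself. -/
abbrev Cochain (x : ι → A) (q : ℕ) : Type _ :=
  (T : {T : Finset ι // T.card = q}) → Loc x T.1

variable [LinearOrder ι]

/-- The face of a `(q+1)`-element set obtained by leaving out the element `i`. -/
def face {q : ℕ} (T : {T : Finset ι // T.card = q + 1}) (i : T.1) :
    {T : Finset ι // T.card = q} :=
  ⟨T.1.erase i.1, by rw [Finset.card_erase_of_mem i.2, T.2]; rfl⟩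

theorem face_subset {q : ℕ} (T : {T : Finset ι // T.card = q + 1}) (i : T.1) :
    (face T i).1 ⊆ T.1 :=
  Finset.erase_subset i.1 T.1

/-- The position of `i` in the set `T`, counted from `0`. -/
def pos (T : Finset ι) (i : ι) : ℕ := (T.filter (· < i)).card

/-- The Čech differential
`(d ω)_T = ∑_{i ∈ T} (-1)^{pos T i} ω_{T ∖ {i}} |_T`. -/
def d (x : ι → A) (q : ℕ) : Cochain x q →ₗ[A] Cochain x (q + 1) :=
  LinearMap.pi fun T => ∑ i : T.1, (-1 : A) ^ pos T.1 i.1 •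
    ((res x (face_subset T i)).toLinearMap ∘ₗ LinearMap.proj (face T i))

theorem d_apply (x : ι → A) (q : ℕ) (ω : Cochain x q) (T : {T : Finset ι // T.card = q + 1}) :
    d x q ω T = ∑ i : T.1, (-1 : A) ^ pos T.1 i.1 •
      res x (face_subset T i) (ω (face T i)) := by
  simp only [d, LinearMap.pi_apply, LinearMap.sum_apply]
  rfl

theorem pos_erase_of_lt (T : Finset ι) {i j : ι} (h : j < i) : pos (T.erase i) j = pos T j := by
  unfold pos
  congr 1
  ext l
  simp only [Finset.mem_filter, Finset.mem_erase]
  exact ⟨fun hl => ⟨hl.1.2, hl.2⟩, fun hl => ⟨⟨(hl.2.trans h).ne, hl.1⟩, hl.2⟩⟩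

theorem pos_erase_of_gt (T : Finset ι) {i j : ι} (hi : i ∈ T) (h : i < j) :
    pos (T.erase i) j + 1 = pos T j := by
  unfold pos
  rw [Finset.filter_erase, Finset.card_erase_add_one]
  simp [hi, h]

/-- The Čech differentials form a complex. -/
theorem d_comp_d (x : ι → A) (q : ℕ) : d x (q + 1) ∘ₗ d x q = 0 := by
  ext ω T
  classical
  let g : Finset ι → Loc x T.1 := fun U =>
    if h : U ⊆ T.1 ∧ U.card = q then res x h.1 (ω ⟨U, h.2⟩) else 0
  have hg : ∀ (i : T.1) (j : (face T i).1),
      res x (face_subset T i)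
        (res x (face_subset (face T i) j) (ω (face (face T i) j))) =
      g ((T.1.erase i.1).erase j.1) := by
    intro i j
    rw [res_res]
    have h : (T.1.erase i.1).erase j.1 ⊆ T.1 ∧ ((T.1.erase i.1).erase j.1).card = q :=
      ⟨(Finset.erase_subset _ _).trans (Finset.erase_subset _ _), (face (face T i) j).2⟩
    simp only [g, dif_pos h]
    rfl
  change d x (q + 1) (d x q ω) T = 0
  rw [d_apply]
  have h1 : ∀ i : T.1, (-1 : A) ^ pos T.1 i.1 •
      res x (face_subset T i) (d x q ω (face T i)) =
      ∑ j ∈ T.1.erase i.1, (-1 : A) ^ (pos T.1 i.1 + pos (T.1.erase i.1) j) •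
        g ((T.1.erase i.1).erase j) := by
    intro i
    rw [d_apply, map_sum, Finset.smul_sum, ← Finset.sum_coe_sort (T.1.erase i.1)]
    refine Finset.sum_congr rfl fun (j : (face T i).1) _ => ?_
    rw [map_smul, hg, smul_smul, ← pow_add]
    rfl
  rw [Finset.sum_congr rfl fun i _ => h1 i,
    Finset.sum_coe_sort T.1 (fun i => ∑ j ∈ T.1.erase i,
      (-1 : A) ^ (pos T.1 i + pos (T.1.erase i) j) • g ((T.1.erase i).erase j)),
    Finset.sum_sigma']
  have key : ∀ i ∈ T.1, ∀ j ∈ T.1, i < j →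
      (-1 : A) ^ (pos T.1 i + pos (T.1.erase i) j) • g ((T.1.erase i).erase j) +
      (-1 : A) ^ (pos T.1 j + pos (T.1.erase j) i) • g ((T.1.erase j).erase i) = 0 := by
    intro i hi j hj hij
    rw [pos_erase_of_lt T.1 hij, ← pos_erase_of_gt T.1 hi hij, Finset.erase_right_comm,
      ← add_smul]
    have : (-1 : A) ^ (pos T.1 i + pos (T.1.erase i) j) +
        (-1 : A) ^ (pos (T.1.erase i) j + 1 + pos T.1 i) = 0 := by ring
    rw [this, zero_smul]
  refine Finset.sum_involution (fun a _ => ⟨a.2, a.1⟩) ?_ ?_ ?_ ?_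
  · rintro ⟨i, j⟩ h
    simp only [Finset.mem_sigma, Finset.mem_erase] at h
    rcases lt_or_gt_of_ne h.2.1 with hlt | hlt
    · exact (add_comm _ _).trans (key j h.2.2 i h.1 hlt)
    · exact key i h.1 j h.2.2 hlt
  · rintro ⟨i, j⟩ h _ he
    simp only [Finset.mem_sigma, Finset.mem_erase] at h
    exact h.2.1 (congrArg Sigma.fst he)
  · rintro ⟨i, j⟩ h
    simp only [Finset.mem_sigma, Finset.mem_erase] at h ⊢
    exact ⟨h.2.2, h.2.1.symm, h.1⟩
  · rintro ⟨i, j⟩ _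
    rfl

/-- The Čech cocycles of degree `q`. -/
abbrev cocycles (x : ι → A) (q : ℕ) : Submodule A (Cochain x q) := LinearMap.ker (d x q)

/-- The Čech coboundaries of degree `q`. -/
def coboundaries (x : ι → A) : (q : ℕ) → Submodule A (Cochain x q)
  | 0 => ⊥
  | q + 1 => LinearMap.range (d x q)

/-- The `q`-th cohomology of the Čech complex on `x`, that is, for a finite family `x` in a
Noetherian ring `A`, the local cohomology `H^q_{(x)}(A)`. -/
abbrev H (x : ι → A) (q : ℕ) : Type _ :=
  cocycles x q ⧸ (coboundaries x q).submoduleOf (cocycles x q)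

/-- Frobenius on Čech cochains: the `p`-th power map on every component. -/
def frobCochain (x : ι → A) (p : ℕ) [Fact p.Prime] (h : (p : A) = 0) (q : ℕ) :
    Cochain x q →+ Cochain x q where
  toFun ω T := frobHom p (natCast_loc x h T.1) (ω T)
  map_zero' := by funext T; simp
  map_add' a b := by funext T; simp

theorem d_frobCochain (x : ι → A) (p : ℕ) [Fact p.Prime] (h : (p : A) = 0) (q : ℕ)
    (ω : Cochain x q) : d x q (frobCochain x p h q ω) = frobCochain x p h (q + 1) (d x q ω) := by
  funext T
  have key : ∀ i : T.1, res x (face_subset T i) (frobCochain x p h q ω (face T i)) =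
      frobHom p (natCast_loc x h T.1) (res x (face_subset T i) (ω (face T i))) :=
    fun i => map_pow _ _ _
  change _ = frobHom p (natCast_loc x h T.1) (d x q ω T)
  rw [d_apply, d_apply, map_sum]
  refine Finset.sum_congr rfl fun i _ => ?_
  rw [key, Algebra.smul_def, Algebra.smul_def, map_mul]
  simp

/-- Frobenius on Čech cocycles. -/
def frobCocycles (x : ι → A) (p : ℕ) [Fact p.Prime] (h : (p : A) = 0) (q : ℕ) :
    cocycles x q →+ cocycles x q :=
  ((frobCochain x p h q).comp (cocycles x q).subtype.toAddMonoidHom).codRestrict (cocycles x q)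
    fun ω => by
      have h0 : d x q ω.1 = 0 := ω.2
      change d x q (frobCochain x p h q ω.1) = 0
      rw [d_frobCochain, h0, map_zero]

theorem frobCochain_mem_coboundaries (x : ι → A) (p : ℕ) [Fact p.Prime] (h : (p : A) = 0) (q : ℕ)
    (ω : Cochain x q) (hω : ω ∈ coboundaries x q) :
    frobCochain x p h q ω ∈ coboundaries x q := by
  cases q with
  | zero =>
    have h0 : ω = 0 := hω
    rw [h0, map_zero]
    exact Submodule.zero_mem _
  | succ q =>
    obtain ⟨η, rfl⟩ := hω
    exact ⟨frobCochain x p h q η, d_frobCochain x p h q η⟩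

/-- The Frobenius action on local cohomology: the additive map induced on Čech cohomology by the
Frobenius endomorphisms of the localizations of `A`. -/
def frob (x : ι → A) (p : ℕ) [Fact p.Prime] (h : (p : A) = 0) (q : ℕ) : H x q →+ H x q :=
  QuotientAddGroup.map _ _ (frobCocycles x p h q)
    fun ω hω => frobCochain_mem_coboundaries x p h q ω.1 hω

end Cech

/-! ### Quotients of a polynomial ring: grading on local cohomology -/

namespace CI

variable {k : Type*} [Field k] {n : ℕ}

/-- The images of the variables `x_0, …, x_n` in `k[x_0, …, x_n] / J`. -/
def vars (J : Ideal (MvPolynomial (Fin (n + 1)) k)) :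
    Fin (n + 1) → MvPolynomial (Fin (n + 1)) k ⧸ J :=
  fun i => Ideal.Quotient.mk J (MvPolynomial.X i)

/-- Local cohomology `H^q_𝔪(R)` of `R = k[x_0, …, x_n] / J`, where `𝔪` is generated by the
variables. -/
abbrev H (J : Ideal (MvPolynomial (Fin (n + 1)) k)) (q : ℕ) : Type _ := Cech.H (vars J) q

/-- The elements of degree `t ∈ ℤ` of the localization of `R = k[x_0, …, x_n] / J` at the product
`x_T` of the variables in `T`: the fractions `a / x_T ^ N` where `a` is (the class of) a form of
degree `t + N |T|`. The degree of a form is taken in `ℤ`, so that `0` is the only form of negative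
degree. -/
def locDeg (J : Ideal (MvPolynomial (Fin (n + 1)) k)) (T : Finset (Fin (n + 1))) (t : ℤ) :
    AddSubgroup (Cech.Loc (vars J) T) where
  carrier := {z | ∃ (N : ℕ) (a : MvPolynomial (Fin (n + 1)) k),
    a.IsWeightedHomogeneous (fun _ => (1 : ℤ)) (t + N * T.card) ∧
    z * algebraMap _ (Cech.Loc (vars J) T) (∏ i ∈ T, vars J i) ^ N =
      algebraMap _ (Cech.Loc (vars J) T) (Ideal.Quotient.mk J a)}
  zero_mem' := ⟨0, 0, MvPolynomial.isWeightedHomogeneous_zero _ _ _, by simp⟩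
  neg_mem' := by
    rintro z ⟨N, a, ha, h⟩
    exact ⟨N, -a, (MvPolynomial.weightedHomogeneousSubmodule k _ _).neg_mem ha, by
      rw [neg_mul, h, map_neg, map_neg]⟩
  add_mem' := by
    rintro z w ⟨N, a, ha, h⟩ ⟨M, b, hb, h'⟩
    have hX : ∀ L : ℕ, ((∏ i ∈ T, MvPolynomial.X i : MvPolynomial (Fin (n + 1)) k) ^ L
        ).IsWeightedHomogeneous (fun _ => (1 : ℤ)) (L * T.card) := by
      intro L
      have h1 := MvPolynomial.IsWeightedHomogeneous.prod T
        (fun i => (MvPolynomial.X i : MvPolynomial (Fin (n + 1)) k)) (fun _ => (1 : ℤ))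
        (w := fun _ => (1 : ℤ))
        (fun i _ => MvPolynomial.isWeightedHomogeneous_X k _ i)
      have h2 := h1.pow L
      simpa using h2
    have hm : ∀ L : ℕ, algebraMap _ (Cech.Loc (vars J) T) (∏ i ∈ T, vars J i) ^ L =
        algebraMap _ (Cech.Loc (vars J) T)
          (Ideal.Quotient.mk J ((∏ i ∈ T, MvPolynomial.X i) ^ L)) := by
      intro L
      simp [vars]
    refine ⟨N + M, a * (∏ i ∈ T, MvPolynomial.X i) ^ M + b * (∏ i ∈ T, MvPolynomial.X i) ^ N,
      ?_, ?_⟩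
    · refine MvPolynomial.IsWeightedHomogeneous.add ?_ ?_
      · convert! ha.mul (hX M) using 1
        push_cast; ring
      · convert! hb.mul (hX N) using 1
        push_cast; ring
    · rw [map_add, map_add, map_mul, map_mul, map_mul, map_mul, ← hm, ← hm, ← h, ← h', pow_add]
      ring

/-- The Čech cochains all of whose components have degree `t`. -/
def cochainDeg (J : Ideal (MvPolynomial (Fin (n + 1)) k)) (q : ℕ) (t : ℤ) :
    AddSubgroup (Cech.Cochain (vars J) q) :=
  AddSubgroup.pi Set.univ fun T => locDeg J T.1 t

/-- The graded piece `H^q_𝔪(R)_t`: the classes of the cocycles of degree `t`. -/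
def gradedPiece (J : Ideal (MvPolynomial (Fin (n + 1)) k)) (q : ℕ) (t : ℤ) :
    AddSubgroup (H J q) :=
  ((cochainDeg J q t).comap (Cech.cocycles (vars J) q).subtype.toAddMonoidHom).map
    (Submodule.mkQ _).toAddMonoidHom

/-- The part `H^q_𝔪(R)_{<0}` of negative degree: the sum of all graded pieces of degree `< 0`. -/
def negPart (J : Ideal (MvPolynomial (Fin (n + 1)) k)) (q : ℕ) : AddSubgroup (H J q) :=
  ⨆ (t : ℤ) (_ : t < 0), gradedPiece J q t

theorem natCast_quot (J : Ideal (MvPolynomial (Fin (n + 1)) k)) (p : ℕ) [CharP k p] :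
    (p : MvPolynomial (Fin (n + 1)) k ⧸ J) = 0 := by
  rw [← map_natCast (algebraMap k (MvPolynomial (Fin (n + 1)) k ⧸ J)), CharP.cast_eq_zero,
    map_zero]

/-- The Frobenius action on `H^q_𝔪(R)`. -/
def frob (J : Ideal (MvPolynomial (Fin (n + 1)) k)) (p : ℕ) [Fact p.Prime] [CharP k p] (q : ℕ) :
    H J q →+ H J q :=
  Cech.frob (vars J) p (natCast_quot J p) q

/-- The ideal of `S = k[x_0, …, x_n]` generated by the `c × c` minors of the Jacobian matrix
`(∂ f_j / ∂ x_i)`. -/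
def jacobianIdeal {c : ℕ} (f : Fin c → MvPolynomial (Fin (n + 1)) k) :
    Ideal (MvPolynomial (Fin (n + 1)) k) :=
  Ideal.span (Set.range fun r : Fin c ↪o Fin (n + 1) =>
    (Matrix.of fun a j : Fin c => MvPolynomial.pderiv (r a) (f j)).det)

end CI

end

/-! Put `J_i = (f_1, …, f_i)`. Čech cohomology of `S/J_i` vanishes below degree `n+1-i`, so
multiplication by the next `f` on `S/J_i` gives an injective connecting map `H^q(S/J_{i+1}) →
H^{q+1}(S/J_i)` with `q = n-i`. Composing these maps embeds `H^{n+1-c}(R)_t` into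
`H^{n+1}(S)_{t-d}`. Images are killed by all `f_j`, and Frobenius on `H^{n+1-c}(R)` becomes
`(f_1⋯f_c)^(p-1) F` on `H^{n+1}(S)` (`RegularChain.exists_top`). A class of `H^{n+1}(S)` is a
fraction `a/(x_0⋯x_n)^m`, and it is zero exactly when `a ∈ (x_0^m, …, x_n^m)`
(`mem_coboundaries_top_iff`).

The theorem thus becomes a statement on polynomials (`mem_powIdeal_of_frobenius`). If `f_j a ∈
(x_i^m)` for all `j`, `(f_1⋯f_c)^(p-1) a^p ∈ Q = (x_i^(mp))` and `deg a + d < m(n+1)`, then `a ∈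
(x_i^m)`. The exponents of the `f_j` are lowered one at a time until `a^p ∈ Q`, and comparing
coefficients then gives the claim. For the descent, suppose every `f_j f^b a^p` lies in `Q`.
Derivations preserve `Q` and kill `a^p`. By Cramer's rule, each Jacobian minor `Δ` is the value at
`f_l` of a derivation killing the other `f_j`, so `Δ f^b a^p ∈ Q` (`det_mul_mem_powIdeal`). Hence
the class of `f^b a^p` is killed by `J` and by all minors.

Such a class vanishes in low degrees (`mem_powIdeal_of_mul_mem`). Over an infinite field, `n+1-c`
suitable linear combinations of the minors extend `f` to a regular sequence of length `n+1`. The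
iterated connecting maps then identify the class with an element of `H^0` whose degree is shifted by
`d + (n+1-c)(d-c)`, and a quotient of `S` has nothing in negative degree. The bound on `p` enters
only here: it makes the shifted degree negative at every stage of the descent.

Projections onto graded components, which commute with the differential and multiply degrees by `p`
under Frobenius, reduce injectivity to cocycles of one degree. -/

noncomputable section

/-! ### Localizations and ring homomorphisms between them. -/

namespace Cech

section Localization

variable {A : Type*} [CommRing A] {ι : Type*}

theorem res_algebraMap (x : ι → A) {T U : Finset ι} (h : T ⊆ U) (a : A) :
    res x h (algebraMap A _ a) = algebraMap A _ a := (res x h).commutes a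

theorem isUnit_algebraMap_prod (x : ι → A) (T : Finset ι) :
    IsUnit (algebraMap A (Loc x T) (∏ i ∈ T, x i)) :=
  isUnit_prod x (Finset.Subset.refl T)

theorem isUnit_algebraMap_mem (x : ι → A) {T : Finset ι} {i : ι} (hi : i ∈ T) :
    IsUnit (algebraMap A (Loc x T) (x i)) :=
  isUnit_of_dvd_unit (map_dvd (algebraMap A (Loc x T)) (Finset.dvd_prod_of_mem x hi)) (isUnit_algebraMap_prod x T)

/-- Every element of the localization is a fraction. -/
theorem exists_frac (x : ι → A) (T : Finset ι) (z : Loc x T) :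
    ∃ (N : ℕ) (a : A), z * algebraMap A (Loc x T) (∏ i ∈ T, x i) ^ N = algebraMap A (Loc x T) a := by
  obtain ⟨N, a, h⟩ := IsLocalization.Away.surj (∏ i ∈ T, x i) z
  exact ⟨N, a, h⟩

/-- A common denominator with exponent at least `M`. -/
theorem exists_frac_ge (x : ι → A) (T : Finset ι) (z : Loc x T) : ∃ N₀ : ℕ, ∀ N, N₀ ≤ N →
    ∃ a : A, z * algebraMap A (Loc x T) (∏ i ∈ T, x i) ^ N = algebraMap A (Loc x T) a := by
  obtain ⟨N₀, a, h⟩ := exists_frac x T z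
  refine ⟨N₀, fun N hN => ⟨a * (∏ i ∈ T, x i) ^ (N - N₀), ?_⟩⟩
  rw [map_mul, ← h, map_pow, mul_assoc, ← pow_add, Nat.add_sub_cancel' hN]

theorem algebraMap_eq_zero_iff' (x : ι → A) (T : Finset ι) (a : A) :
    algebraMap A (Loc x T) a = 0 ↔ ∃ N : ℕ, (∏ i ∈ T, x i) ^ N * a = 0 := by
  rw [IsLocalization.map_eq_zero_iff (Submonoid.powers (∏ i ∈ T, x i))]
  constructor
  · rintro ⟨⟨_, N, rfl⟩, h⟩
    exact ⟨N, h⟩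
  · rintro ⟨N, h⟩
    exact ⟨⟨_, N, rfl⟩, h⟩

theorem smul_loc_eq_zero (x : ι → A) (T : Finset ι) {h : A} (hh : ∀ a, h * a = 0 → a = 0)
    (w : Loc x T) (hw : h • w = 0) : w = 0 := by
  obtain ⟨N, a, ha⟩ := exists_frac x T w
  have h1 : algebraMap A (Loc x T) (h * a) = 0 := by
    rw [map_mul, ← ha, ← mul_assoc, ← Algebra.smul_def, hw, zero_mul]
  obtain ⟨M, hM⟩ := (algebraMap_eq_zero_iff' x T _).1 h1
  have h2 : (∏ i ∈ T, x i) ^ M * a = 0 := hh _ (by rw [← hM]; ring)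
  have h3 := (algebraMap_eq_zero_iff' x T a).2 ⟨M, h2⟩
  rw [h3] at ha
  exact (((isUnit_algebraMap_prod x T).pow N).mul_left_eq_zero).1 ha

variable {B : Type*} [CommRing B] (π : A →+* B) {x : ι → A} {y : ι → B}

/-- The map induced on localizations by a ring homomorphism compatible with the families. -/
def locMap (hxy : ∀ i, π (x i) = y i) (T : Finset ι) : Loc x T →+* Loc y T :=
  IsLocalization.Away.lift (∏ i ∈ T, x i) (g := (algebraMap B (Loc y T)).comp π) (by
    rw [RingHom.comp_apply, map_prod, Finset.prod_congr rfl fun i _ => hxy i]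
    exact isUnit_algebraMap_prod y T)

variable (hxy : ∀ i, π (x i) = y i)

@[simp]
theorem locMap_algebraMap (T : Finset ι) (a : A) :
    locMap π hxy T (algebraMap A _ a) = algebraMap B _ (π a) :=
  IsLocalization.Away.lift_eq _ _ a

theorem locMap_smul (T : Finset ι) (a : A) (z : Loc x T) :
    locMap π hxy T (a • z) = π a • locMap π hxy T z := by
  rw [Algebra.smul_def, map_mul, locMap_algebraMap, Algebra.smul_def]

include hxy in
theorem map_prod_vars (T : Finset ι) : π (∏ i ∈ T, x i) = ∏ i ∈ T, y i := by
  rw [map_prod, Finset.prod_congr rfl fun i _ => hxy i]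

theorem locMap_res {T U : Finset ι} (h : T ⊆ U) (z : Loc x T) :
    locMap π hxy U (res x h z) = res y h (locMap π hxy T z) := by
  have : (locMap π hxy U).comp (res x h).toRingHom =
      (res y h).toRingHom.comp (locMap π hxy T) := by
    refine IsLocalization.ringHom_ext (Submonoid.powers (∏ i ∈ T, x i)) ?_
    ext a
    simp
  exact DFunLike.congr_fun this z

theorem locMap_surjective (hπ : Function.Surjective π) (T : Finset ι) :
    Function.Surjective (locMap π hxy T) := by
  intro w
  obtain ⟨N, b, hb⟩ := exists_frac y T w
  obtain ⟨a, rfl⟩ := hπ b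
  obtain ⟨u, hu⟩ := (isUnit_algebraMap_prod x T).pow N
  refine ⟨algebraMap A _ a * ↑u⁻¹, ?_⟩
  have h1 : IsUnit (algebraMap B (Loc y T) (∏ i ∈ T, y i) ^ N) :=
    (isUnit_algebraMap_prod y T).pow N
  refine h1.mul_left_injective ?_
  change locMap π hxy T _ * _ = w * _
  have h2 : algebraMap B (Loc y T) (∏ i ∈ T, y i) =
      locMap π hxy T (algebraMap A _ (∏ i ∈ T, x i)) := by
    rw [locMap_algebraMap, map_prod_vars π hxy]
  rw [hb, h2, ← map_pow, ← map_mul, ← hu, mul_assoc, Units.inv_mul, mul_one, locMap_algebraMap]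

theorem locMap_eq_zero {h : A} (hker : ∀ a, π a = 0 → ∃ b, a = h * b) (T : Finset ι)
    (z : Loc x T) (hz : locMap π hxy T z = 0) : ∃ w, z = h • w := by
  obtain ⟨N, a, ha⟩ := exists_frac x T z
  have h1 : algebraMap B (Loc y T) (π a) = 0 := by
    rw [← locMap_algebraMap π hxy, ← ha, map_mul, hz, zero_mul]
  obtain ⟨M, hM⟩ := (algebraMap_eq_zero_iff' y T _).1 h1
  rw [← map_prod_vars π hxy, ← map_pow, ← map_mul] at hM
  obtain ⟨b, hb⟩ := hker _ hM
  obtain ⟨u, hu⟩ := (isUnit_algebraMap_prod x T).pow (M + N)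
  refine ⟨algebraMap A _ b * ↑u⁻¹, ?_⟩
  rw [Algebra.smul_def, ← mul_assoc, ← map_mul, ← hb, map_mul, ← ha, map_pow, mul_left_comm,
    ← pow_add, mul_assoc, ← hu, Units.mul_inv, mul_one]

end Localization

/-! ### Čech complexes of `A` and `A / h`: the long exact sequence. -/

section Cochain

variable {A : Type*} [CommRing A] {ι : Type*} {B : Type*} [CommRing B] (π : A →+* B) {x : ι → A}
  {y : ι → B} (hxy : ∀ i, π (x i) = y i)

/-- The map induced on Čech cochains. -/
def cochainMap (q : ℕ) : Cochain x q →+ Cochain y q where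
  toFun ω T := locMap π hxy T.1 (ω T)
  map_zero' := by funext T; simp
  map_add' a b := by funext T; simp

theorem cochainMap_apply (q : ℕ) (ω : Cochain x q) (T) :
    cochainMap π hxy q ω T = locMap π hxy T.1 (ω T) := rfl

theorem cochainMap_smul (q : ℕ) (a : A) (ω : Cochain x q) :
    cochainMap π hxy q (a • ω) = π a • cochainMap π hxy q ω := by
  funext T
  exact locMap_smul π hxy T.1 a (ω T)

theorem cochainMap_surjective (hπ : Function.Surjective π) (q : ℕ) :
    Function.Surjective (cochainMap π hxy q) := by
  intro ω
  have h (T) : ∃ w, locMap π hxy T.1 w = ω T := locMap_surjective π hxy hπ T.1 (ω T)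
  exact ⟨fun T => (h T).choose, funext fun T => (h T).choose_spec⟩

theorem cochainMap_eq_zero {h : A} (hker : ∀ a, π a = 0 → ∃ b, a = h * b) (q : ℕ)
    (ω : Cochain x q) (hω : cochainMap π hxy q ω = 0) : ∃ μ, ω = h • μ := by
  have h (T) : ∃ w, ω T = h • w := locMap_eq_zero π hxy hker T.1 (ω T) (congrFun hω T)
  exact ⟨fun T => (h T).choose, funext fun T => (h T).choose_spec⟩

theorem smul_cochain_eq_zero {h : A} (hh : ∀ a, h * a = 0 → a = 0) {q : ℕ} (ω : Cochain x q)
    (hω : h • ω = 0) : ω = 0 :=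
  funext fun T => smul_loc_eq_zero x T.1 hh (ω T) (congrFun hω T)

variable [LinearOrder ι]

theorem cochainMap_d (q : ℕ) (ω : Cochain x q) :
    cochainMap π hxy (q + 1) (d x q ω) = d y q (cochainMap π hxy q ω) := by
  funext T
  rw [cochainMap_apply, d_apply, d_apply, map_sum]
  refine Finset.sum_congr rfl fun i _ => ?_
  rw [locMap_smul, locMap_res, map_pow, map_neg, map_one]
  rfl

theorem d_d (x : ι → A) (q : ℕ) (ω : Cochain x q) : d x (q + 1) (d x q ω) = 0 :=
  DFunLike.congr_fun (d_comp_d x q) ω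

theorem d_eq_zero_of_mem_coboundaries (x : ι → A) {q : ℕ} {ω : Cochain x q}
    (h : ω ∈ coboundaries x q) : d x q ω = 0 := by
  cases q with
  | zero =>
    have h0 : ω = 0 := h
    rw [h0, map_zero]
  | succ q =>
    obtain ⟨η, rfl⟩ := h
    exact d_d x q η

theorem cochainMap_mem_coboundaries {q : ℕ} {ω : Cochain x q} (h : ω ∈ coboundaries x q) :
    cochainMap π hxy q ω ∈ coboundaries y q := by
  cases q with
  | zero =>
    have h0 : ω = 0 := h
    rw [h0, map_zero]
    exact Submodule.zero_mem _
  | succ q =>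
    obtain ⟨η, rfl⟩ := h
    exact ⟨cochainMap π hxy q η, (cochainMap_d π hxy q η).symm⟩

theorem exists_coboundary_lift (hπ : Function.Surjective π) {q : ℕ} {ω : Cochain y q}
    (h : ω ∈ coboundaries y q) : ∃ β ∈ coboundaries x q, cochainMap π hxy q β = ω := by
  cases q with
  | zero =>
    have h0 : ω = 0 := h
    exact ⟨0, Submodule.zero_mem _, by rw [h0, map_zero]⟩
  | succ q =>
    obtain ⟨η, rfl⟩ := h
    obtain ⟨μ, rfl⟩ := cochainMap_surjective π hxy hπ q η
    exact ⟨d x q μ, ⟨μ, rfl⟩, cochainMap_d π hxy q μ⟩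

/-- The `q`-th Čech cohomology vanishes. -/
def Vanishes (x : ι → A) (q : ℕ) : Prop := ∀ ω : Cochain x q, d x q ω = 0 → ω ∈ coboundaries x q

variable {h : A} (hπ : Function.Surjective π) (hker : ∀ a, π a = 0 ↔ ∃ b, a = h * b)
  (hh : ∀ a, h * a = 0 → a = 0)

include hxy hπ hker hh

/-- The connecting homomorphism `H^q(A / h) → H^{q+1}(A)` is injective if `H^q(A) = 0`. -/
theorem cochainMap_mem_coboundaries_iff {q : ℕ} (hv : Vanishes x q) {ω : Cochain x q}
    {η : Cochain x (q + 1)} (hη : d x q ω = h • η) :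
    cochainMap π hxy q ω ∈ coboundaries y q ↔ η ∈ coboundaries x (q + 1) := by
  have hπh : π h = 0 := (hker h).2 ⟨1, (mul_one h).symm⟩
  constructor
  · intro hω
    obtain ⟨β, hβ, hβω⟩ := exists_coboundary_lift π hxy hπ hω
    -- Modulo coboundaries `ω = h • μ`, so `d ω = h • d μ`; cancelling `h` yields `d μ = η`.
    obtain ⟨μ, hμ⟩ := cochainMap_eq_zero π hxy (fun a => (hker a).1) q (ω - β)
      (by rw [map_sub, hβω, sub_self])
    refine ⟨μ, ?_⟩
    rw [← sub_eq_zero]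
    refine smul_cochain_eq_zero hh _ ?_
    rw [smul_sub, ← map_smul, ← hμ, map_sub, d_eq_zero_of_mem_coboundaries x hβ, sub_zero, hη,
      sub_self]
  · rintro ⟨μ, rfl⟩
    have h1 := cochainMap_mem_coboundaries π hxy (hv (ω - h • μ) (by
      rw [map_sub, hη, map_smul, sub_self]))
    rwa [map_sub, cochainMap_smul, hπh, zero_smul, sub_zero] at h1

-- Snake lemma: a cochain that is a cocycle modulo `h` has differential divisible by `h`. The
-- quotient `η` is again a cocycle because `h` is a nonzerodivisor on every localization.
omit hπ in
theorem exists_d_eq_smul {q : ℕ} (ω : Cochain x q) (hω : d y q (cochainMap π hxy q ω) = 0) :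
    ∃ η, d x q ω = h • η ∧ d x (q + 1) η = 0 := by
  rw [← cochainMap_d] at hω
  obtain ⟨η, hη⟩ := cochainMap_eq_zero π hxy (fun a => (hker a).1) _ _ hω
  refine ⟨η, hη, smul_cochain_eq_zero hh _ ?_⟩
  rw [← map_smul, ← hη, d_d]

/-- Exactness of `H^q(A) → H^q(A / h) → H^{q+1}(A)` at the middle term. -/
theorem Vanishes.quotient {q : ℕ} (hv : Vanishes x q) (hv' : Vanishes x (q + 1)) :
    Vanishes y q := by
  intro ω hω
  obtain ⟨ω, rfl⟩ := cochainMap_surjective π hxy hπ q ω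
  obtain ⟨η, hη, hdη⟩ := exists_d_eq_smul π hxy hker hh ω hω
  exact (cochainMap_mem_coboundaries_iff π hxy hπ hker hh hv hη).2 (hv' η hdη)

/-- Multiplication by `h` is injective on `H^q(A)` if `H^{q-1}(A / h) = 0`. -/
theorem mem_coboundaries_of_smul_mem {q : ℕ} (hv : ∀ r, r + 1 = q → Vanishes y r)
    {ω : Cochain x q} (hω : h • ω ∈ coboundaries x q) : ω ∈ coboundaries x q := by
  have hπh : π h = 0 := (hker h).2 ⟨1, (mul_one h).symm⟩
  cases q with
  | zero =>
    have h0 : h • ω = 0 := hω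
    have : ω = 0 := smul_cochain_eq_zero hh _ h0
    rw [this]
    exact Submodule.zero_mem _
  | succ q =>
    obtain ⟨ν, hν⟩ := hω
    have h1 : d y q (cochainMap π hxy q ν) = 0 := by
      rw [← cochainMap_d, hν, cochainMap_smul, hπh, zero_smul]
    -- With `h • ω = d ν`, the reduction of `ν` is a cocycle, hence a coboundary. Subtracting a lift
    -- `β` of it makes `ν` divisible by `h` without changing `d ν`.
    obtain ⟨β, hβ, hβν⟩ := exists_coboundary_lift π hxy hπ (hv q rfl _ h1)
    obtain ⟨μ, hμ⟩ := cochainMap_eq_zero π hxy (fun a => (hker a).1) q (ν - β)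
      (by rw [map_sub, hβν, sub_self])
    refine ⟨μ, ?_⟩
    rw [← sub_eq_zero]
    refine smul_cochain_eq_zero hh _ ?_
    rw [smul_sub, ← map_smul, ← hμ, map_sub, d_eq_zero_of_mem_coboundaries x hβ, sub_zero, hν,
      sub_self]

end Cochain

end Cech

/-! ### Čech cohomology is torsion with respect to each `x i`. -/

namespace Cech

section Torsion

variable {A : Type*} [CommRing A] {ι : Type*} [LinearOrder ι] {x : ι → A}

/-- Inverting a nonzerodivisor loses nothing, so identities over `T` may be checked over `insert i
T`. -/
theorem eq_zero_of_res_insert {i : ι} (hi : ∀ a, x i * a = 0 → a = 0) {T : Finset ι}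
    (z : Loc x T) (hz : res x (Finset.subset_insert i T) z = 0) : z = 0 := by
  by_cases hiT : i ∈ T
  · have h1 : res x (Finset.insert_subset hiT (Finset.Subset.refl T))
        (res x (Finset.subset_insert i T) z) = z := by
      rw [res_res]
      exact DFunLike.congr_fun ((IsLocalization.algHom_subsingleton
        (Submonoid.powers (∏ i ∈ T, x i))).elim (res x _) (AlgHom.id A _)) z
    rw [← h1, hz, map_zero]
  obtain ⟨N, a, ha⟩ := exists_frac x T z
  have h1 : algebraMap A (Loc x (insert i T)) a = 0 := by
    rw [← res_algebraMap x (Finset.subset_insert i T), ← ha, map_mul, hz, zero_mul]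
  obtain ⟨M, hM⟩ := (algebraMap_eq_zero_iff' x _ a).1 h1
  rw [Finset.prod_insert hiT, mul_pow, mul_assoc] at hM
  have h2 : ∀ (M : ℕ) (b : A), x i ^ M * b = 0 → b = 0 := by
    intro M
    induction M with
    | zero => intro b hb; simpa using hb
    | succ M ih => intro b hb; exact ih b (hi _ (by rw [← hb]; ring))
  have h3 := (algebraMap_eq_zero_iff' x T a).2 ⟨M, h2 M _ hM⟩
  rw [h3] at ha
  exact (((isUnit_algebraMap_prod x T).pow N).mul_left_eq_zero).1 ha

/-- The only new denominators over `insert i U` are powers of `x i`. All large exponents are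
provided, so that finitely many components can share one. -/
theorem exists_res_eq_pow_smul {i : ι} {U : Finset ι} (hi : i ∉ U) (z : Loc x (insert i U)) :
    ∃ M₀ : ℕ, ∀ M, M₀ ≤ M → ∃ w : Loc x U, res x (Finset.subset_insert i U) w = x i ^ M • z := by
  obtain ⟨N, a, ha⟩ := exists_frac x _ z
  refine ⟨N, fun M hM => ?_⟩
  obtain ⟨u, hu⟩ := (isUnit_algebraMap_prod x U).pow N
  refine ⟨algebraMap A _ (a * x i ^ (M - N)) * ↑u⁻¹, ?_⟩
  refine ((isUnit_algebraMap_prod x (insert i U)).pow N).mul_left_injective ?_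
  change res x _ _ * _ = (x i ^ M • z) * _
  have h1 : algebraMap A (Loc x (insert i U)) (∏ i ∈ U, x i) ^ N =
      res x (Finset.subset_insert i U) u := by
    rw [hu, map_pow, res_algebraMap]
  have h2 : algebraMap A (Loc x (insert i U)) (∏ i ∈ insert i U, x i) ^ N =
      algebraMap A _ (x i ^ N) * res x (Finset.subset_insert i U) u := by
    rw [← h1, ← map_pow, ← map_pow, ← map_mul]
    exact congrArg _ (by rw [Finset.prod_insert hi, mul_pow])
  rw [smul_mul_assoc, ha, h2, map_mul, res_algebraMap, mul_mul_mul_comm, ← map_mul, ← map_mul,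
    Units.inv_mul, map_one, mul_one, Algebra.smul_def, ← map_mul]
  congr 1
  rw [mul_assoc, ← pow_add, Nat.sub_add_cancel hM, mul_comm]

omit [LinearOrder ι] in
theorem res_congr {q : ℕ} (ω : Cochain x q) {U U' V : Finset ι} (h : U = U') (hU : U.card = q)
    (hUV : U ⊆ V) :
    res x hUV (ω ⟨U, hU⟩) = res x (h ▸ hUV) (ω ⟨U', h ▸ hU⟩) := by
  subst h
  rfl

theorem pos_insert_self (T : Finset ι) (i : ι) : pos (insert i T) i = pos T i := by
  unfold pos
  rw [Finset.filter_insert, if_neg (lt_irrefl i)]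

/-- The sign rule that makes the contraction `ω ↦ (U ↦ ± ω_{U ∪ {i}})` a homotopy. -/
theorem neg_one_pow_pos {T : Finset ι} {i j : ι} (hi : i ∉ T) (hj : j ∈ T) :
    (-1 : A) ^ (pos (insert i T) i + (pos T j + pos (T.erase j) i)) =
      -(-1) ^ pos (insert i T) j := by
  have hij : j ≠ i := fun h => hi (h ▸ hj)
  rw [pos_insert_self]
  rcases lt_or_gt_of_ne hij with h | h
  · have h1 := pos_erase_of_gt T hj h
    have h2 := pos_erase_of_lt (insert i T) h
    rw [Finset.erase_insert hi] at h2
    rw [← h2, ← h1, show pos (T.erase j) i + 1 + (pos T j + pos (T.erase j) i) =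
      pos T j + 1 + (pos (T.erase j) i + pos (T.erase j) i) by ring, pow_add,
      Even.neg_one_pow ⟨_, rfl⟩]
    ring
  · have h1 := pos_erase_of_lt T h
    have h2 := pos_erase_of_gt (insert i T) (Finset.mem_insert_self i T) h
    rw [Finset.erase_insert hi] at h2
    rw [← h2, h1, show pos T i + (pos T j + pos T i) = pos T j + (pos T i + pos T i) by ring,
      pow_add, Even.neg_one_pow (n := pos T i + pos T i) ⟨_, rfl⟩]
    ring

theorem card_insert_erase {T : Finset ι} {i : ι} (hi : i ∉ T) {j : ι} (hj : j ∈ T) :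
    (insert i (T.erase j)).card = T.card := by
  rw [Finset.card_insert_of_notMem fun h => hi (Finset.mem_of_mem_erase h),
    Finset.card_erase_add_one hj]

theorem d_apply_insert {q : ℕ} (ω : Cochain x q) {T : Finset ι} {i : ι} (hi : i ∉ T)
    (hT : T.card = q) :
    d x q ω ⟨insert i T, by rw [Finset.card_insert_of_notMem hi, hT]⟩ =
      (-1 : A) ^ pos (insert i T) i • res x (Finset.subset_insert i T) (ω ⟨T, hT⟩) +
      ∑ j : T, (-1 : A) ^ pos (insert i T) j.1 •
        res x (Finset.insert_subset_insert i (Finset.erase_subset j.1 T))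
          (ω ⟨insert i (T.erase j.1), (card_insert_erase hi j.2).trans hT⟩) := by
  rw [d_apply]
  have hV : (insert i T).card = q + 1 := by rw [Finset.card_insert_of_notMem hi, hT]
  let G : ι → Loc x (insert i T) := fun j => if hj : j ∈ insert i T then
    (-1 : A) ^ pos (insert i T) j • res x (face_subset ⟨insert i T, hV⟩ ⟨j, hj⟩)
      (ω (face ⟨insert i T, hV⟩ ⟨j, hj⟩)) else 0
  have h1 : ∀ j : (insert i T : Finset ι), (-1 : A) ^ pos (insert i T) j.1 •
      res x (face_subset ⟨insert i T, hV⟩ j) (ω (face ⟨insert i T, hV⟩ j)) = G j.1 :=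
    fun j => by simp only [G, dif_pos j.2]
  rw [Finset.sum_congr rfl fun j _ => h1 j, Finset.sum_coe_sort (insert i T) G,
    Finset.sum_insert hi]
  congr 1
  · simp only [G, dif_pos (Finset.mem_insert_self i T)]
    congr 1
    exact res_congr ω (Finset.erase_insert hi) _ _
  · rw [← Finset.sum_coe_sort T]
    refine Finset.sum_congr rfl fun j _ => ?_
    have hj : j.1 ∈ insert i T := Finset.mem_insert_of_mem j.2
    simp only [G, dif_pos hj]
    congr 1
    exact res_congr ω (Finset.erase_insert_of_ne fun h : i = j.1 => hi (h.symm ▸ j.2)) _ _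

theorem smul_eq_zero_of_neg_one_pow {M : Type*} [AddCommGroup M] [Module A M] {r : ℕ} {z : M}
    (h : (-1 : A) ^ r • z = 0) : z = 0 := by
  have h1 := congrArg (fun w => (-1 : A) ^ r • w) h
  simpa only [smul_smul, ← pow_add, Even.neg_one_pow (n := r + r) ⟨r, rfl⟩, one_smul,
    smul_zero] using h1

/-- Čech cohomology is `x i`-power torsion. -/
theorem exists_pow_smul_mem_coboundaries [Finite ι] {i : ι} (hi : ∀ a, x i * a = 0 → a = 0) {q : ℕ}
    (ω : Cochain x q) (hω : d x q ω = 0) : ∃ M : ℕ, x i ^ M • ω ∈ coboundaries x q := by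
  cases q with
  | zero =>
    refine ⟨0, ?_⟩
    rw [pow_zero, one_smul]
    change ω = 0
    funext T
    obtain ⟨T, hT⟩ := T
    obtain rfl := Finset.card_eq_zero.1 hT
    refine eq_zero_of_res_insert hi _ ?_
    have h1 := congrFun hω ⟨insert i ∅, by simp⟩
    rw [d_apply_insert ω (Finset.notMem_empty i) rfl, Finset.univ_eq_empty, Finset.sum_empty,
      add_zero] at h1
    exact smul_eq_zero_of_neg_one_pow h1
  | succ q =>
    have h1 (U : {U : Finset ι // U.card = q}) (hU : i ∉ U.1) :=
      exists_res_eq_pow_smul hU (ω ⟨insert i U.1, by rw [Finset.card_insert_of_notMem hU, U.2]⟩)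
    choose! M₀ hM₀ using h1
    obtain ⟨M, hM⟩ := (Set.finite_range M₀).bddAbove
    have h2 (U : {U : Finset ι // U.card = q}) (hU : i ∉ U.1) := hM₀ U hU M (hM ⟨U, rfl⟩)
    choose w hw using h2
    -- The primitive is the contraction with `i`: on `U ∌ i` it extends `± x i ^ M • ω_{U ∪ {i}}`
    -- over `U`, and it is zero on `U ∋ i`.
    refine ⟨M, ⟨fun U => if hU : i ∈ U.1 then 0 else (-1 : A) ^ pos U.1 i • w U hU, ?_⟩⟩
    funext T
    obtain ⟨T, hT⟩ := T
    rw [d_apply]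
    by_cases hiT : i ∈ T
    · rw [Finset.sum_eq_single ⟨i, hiT⟩]
      · have h3 : i ∉ (face ⟨T, hT⟩ ⟨i, hiT⟩).1 := Finset.notMem_erase i T
        have h4 : pos (T.erase i) i = pos T i := by
          rw [← pos_insert_self, Finset.insert_erase hiT]
        have h5 : res x (face_subset ⟨T, hT⟩ ⟨i, hiT⟩) (w (face ⟨T, hT⟩ ⟨i, hiT⟩) h3) =
            x i ^ M • ω ⟨T, hT⟩ := by
          have h6 := fun V (hV : insert i (T.erase i) = V) => congrArg
            (res x (le_of_eq hV)) (hw (face ⟨T, hT⟩ ⟨i, hiT⟩) h3)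
          have h7 := h6 T (Finset.insert_erase hiT)
          refine (res_res x _ _ _).symm.trans (h7.trans ((map_smul (res x _) _ _).trans
            (congrArg (x i ^ M • ·) ?_)))
          refine (res_congr ω (Finset.insert_erase hiT) _ _).trans ?_
          exact DFunLike.congr_fun ((IsLocalization.algHom_subsingleton
            (Submonoid.powers (∏ i ∈ T, x i))).elim (res x _) (AlgHom.id A _)) _
        rw [dif_neg h3, map_smul, smul_smul, ← pow_add, h5]
        change (-1 : A) ^ (pos T i + pos (T.erase i) i) • _ = _
        rw [h4, Even.neg_one_pow ⟨_, rfl⟩, one_smul]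
        rfl
      · intro j _ hj
        have h3 : i ∈ (face ⟨T, hT⟩ j).1 :=
          Finset.mem_erase.2 ⟨fun h => hj (Subtype.ext h.symm), hiT⟩
        rw [dif_pos h3, map_zero, smul_zero]
      · intro h
        exact absurd (Finset.mem_univ _) h
    · rw [← sub_eq_zero]
      -- After restriction to `insert i T` the claim is `x i ^ M` times the cocycle condition of `ω`
      -- at `insert i T`.
      refine eq_zero_of_res_insert hi _ ?_
      have h3 := congrFun hω ⟨insert i T, by rw [Finset.card_insert_of_notMem hiT, hT]⟩
      rw [d_apply_insert ω hiT hT] at h3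
      refine smul_eq_zero_of_neg_one_pow (A := A) (r := pos (insert i T) i) ?_
      have h4 := congrArg (fun z => x i ^ M • z) h3
      simp only [smul_add, Pi.zero_apply, smul_zero, Finset.smul_sum] at h4
      rw [add_comm, ← eq_neg_iff_add_eq_zero] at h4
      rw [map_sub, map_sum, smul_sub, Finset.smul_sum, sub_eq_zero, Pi.smul_apply, map_smul,
        smul_comm _ (x i ^ M)]
      have h5 : ∀ j : T, (-1 : A) ^ pos (insert i T) i • res x (Finset.subset_insert i T)
          ((-1 : A) ^ pos T j.1 • res x (face_subset ⟨T, hT⟩ j)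
            (if hU : i ∈ (face ⟨T, hT⟩ j).1 then 0 else
              (-1 : A) ^ pos (face ⟨T, hT⟩ j).1 i • w (face ⟨T, hT⟩ j) hU)) =
          -(x i ^ M • (-1 : A) ^ pos (insert i T) j.1 •
            res x (Finset.insert_subset_insert i (Finset.erase_subset j.1 T))
              (ω ⟨insert i (T.erase j.1), (card_insert_erase hiT j.2).trans hT⟩)) := by
        intro j
        have h6 : i ∉ (face ⟨T, hT⟩ j).1 := fun h => hiT (Finset.mem_of_mem_erase h)
        have h7 := congrArg (res x (Finset.insert_subset_insert i (Finset.erase_subset j.1 T)))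
          (hw (face ⟨T, hT⟩ j) h6)
        have h9 : res x (Finset.subset_insert i T)
            (res x (face_subset ⟨T, hT⟩ j) (w (face ⟨T, hT⟩ j) h6)) = x i ^ M •
            res x (Finset.insert_subset_insert i (Finset.erase_subset j.1 T))
              (ω ⟨insert i (T.erase j.1), (card_insert_erase hiT j.2).trans hT⟩) :=
          (res_res x _ _ _).trans
            ((res_res x _ _ _).symm.trans (h7.trans (map_smul (res x _) _ _)))
        rw [dif_neg h6, map_smul (res x (face_subset _ _)), smul_smul,
          map_smul (res x (Finset.subset_insert i T)), smul_smul]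
        refine (congrArg (_ • ·) h9).trans ?_
        have h8 := neg_one_pow_pos (A := A) hiT j.2
        rw [pow_add, pow_add] at h8
        change ((-1 : A) ^ pos (insert i T) i * ((-1) ^ pos T j.1 * (-1) ^ pos (T.erase j.1) i)) • _
          = _
        rw [h8, neg_smul, smul_comm]
      rw [Finset.sum_congr rfl fun j _ => h5 j, Finset.sum_neg_distrib, h4, neg_neg]

variable {B : Type*} [CommRing B] (π : A →+* B) {y : ι → B} (hxy : ∀ i, π (x i) = y i)

-- Multiplication by `x i` is injective on `H^q(A)` as soon as `H^{q-1}(A / x i)` vanishes, while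
-- every class is killed by a power of `x i`.
include hxy in
theorem Vanishes.of_quotient [Finite ι] (hπ : Function.Surjective π) {i : ι}
    (hker : ∀ a, π a = 0 ↔ ∃ b, a = x i * b) (hh : ∀ a, x i * a = 0 → a = 0) {q : ℕ}
    (hv : ∀ r, r + 1 = q → Vanishes y r) : Vanishes x q := by
  intro ω hω
  obtain ⟨M, hM⟩ := exists_pow_smul_mem_coboundaries hh ω hω
  induction M with
  | zero => simpa using hM
  | succ M ih =>
    rw [pow_succ', mul_smul] at hM
    exact ih (mem_coboundaries_of_smul_mem π hxy hπ hker hh hv hM)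

end Torsion

end Cech

/-! ### The grading on localizations of `k[x] / J`. -/

namespace CI

open Cech LaurentPolynomial

variable {k : Type*} [Field k] {n : ℕ}

/-- Forms of degree `t ∈ ℤ`, where every variable has degree `1`. -/
abbrev IsForm (a : MvPolynomial (Fin (n + 1)) k) (t : ℤ) : Prop :=
  a.IsWeightedHomogeneous (fun _ => (1 : ℤ)) t

theorem weight_one_int (m : Fin (n + 1) →₀ ℕ) :
    Finsupp.weight (fun _ => (1 : ℤ)) m = (m.degree : ℤ) := by
  rw [Finsupp.weight_apply, Finsupp.sum, Finsupp.degree_apply]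
  simp

theorem isForm_iff {a : MvPolynomial (Fin (n + 1)) k} {t : ℤ} :
    IsForm a t ↔ ∀ m, a.coeff m ≠ 0 → (m.degree : ℤ) = t := by
  unfold IsForm MvPolynomial.IsWeightedHomogeneous
  simp only [weight_one_int]

theorem IsForm.of_isHomogeneous {a : MvPolynomial (Fin (n + 1)) k} {e : ℕ}
    (h : a.IsHomogeneous e) : IsForm a e :=
  isForm_iff.2 fun m hm => by
    rw [← h hm, Finsupp.weight_apply, Finsupp.sum, Finsupp.degree_apply]
    simp

theorem IsForm.eq_zero_of_neg {a : MvPolynomial (Fin (n + 1)) k} {t : ℤ} (h : IsForm a t)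
    (ht : t < 0) : a = 0 := by
  ext m
  by_contra hm
  have := isForm_iff.1 h m hm
  omega

theorem isForm_prod_X (T : Finset (Fin (n + 1))) (L : ℕ) :
    IsForm ((∏ i ∈ T, MvPolynomial.X i : MvPolynomial (Fin (n + 1)) k) ^ L) (L * T.card) := by
  have h1 := MvPolynomial.IsWeightedHomogeneous.prod T
    (fun i => (MvPolynomial.X i : MvPolynomial (Fin (n + 1)) k)) (fun _ => (1 : ℤ))
    (w := fun _ => (1 : ℤ)) (fun i _ => MvPolynomial.isWeightedHomogeneous_X k _ i)
  simpa using h1.pow L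

/-- Every polynomial is a sum of forms. -/
theorem sum_form (a : MvPolynomial (Fin (n + 1)) k) :
    ∃ (s : Finset ℤ) (b : ℤ → MvPolynomial (Fin (n + 1)) k), (∀ t, IsForm (b t) t) ∧
      a = ∑ t ∈ s, b t := by
  refine ⟨(Finset.range (a.totalDegree + 1)).image (fun j : ℕ => (j : ℤ)),
    fun t => if 0 ≤ t then MvPolynomial.homogeneousComponent t.toNat a else 0, fun t => ?_, ?_⟩
  · dsimp only
    split_ifs with h
    · have h1 := IsForm.of_isHomogeneous
        (MvPolynomial.homogeneousComponent_isHomogeneous t.toNat a)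
      rwa [Int.toNat_of_nonneg h] at h1
    · exact MvPolynomial.isWeightedHomogeneous_zero _ _ _
  · rw [Finset.sum_image fun i _ j _ h => by exact_mod_cast h]
    simp [MvPolynomial.sum_homogeneousComponent]

/-- The map `a ↦ a / 1` from polynomials to a localization of `k[x] / J`. -/
def toLoc (J : Ideal (MvPolynomial (Fin (n + 1)) k)) (T : Finset (Fin (n + 1))) :
    MvPolynomial (Fin (n + 1)) k →+* Loc (vars J) T :=
  (algebraMap (MvPolynomial (Fin (n + 1)) k ⧸ J) (Loc (vars J) T)).comp (Ideal.Quotient.mk J)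

theorem toLoc_apply (J : Ideal (MvPolynomial (Fin (n + 1)) k)) (T : Finset (Fin (n + 1)))
    (a : MvPolynomial (Fin (n + 1)) k) :
    toLoc J T a = algebraMap _ (Loc (vars J) T) (Ideal.Quotient.mk J a) := rfl

theorem mk_prod_X (J : Ideal (MvPolynomial (Fin (n + 1)) k)) (T : Finset (Fin (n + 1))) :
    Ideal.Quotient.mk J (∏ i ∈ T, MvPolynomial.X i) = ∏ i ∈ T, vars J i := map_prod _ _ _

theorem toLoc_prod_X (J : Ideal (MvPolynomial (Fin (n + 1)) k)) (T : Finset (Fin (n + 1))) :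
    toLoc J T (∏ i ∈ T, MvPolynomial.X i) =
      algebraMap _ (Loc (vars J) T) (∏ i ∈ T, vars J i) :=
  congrArg (algebraMap _ (Loc (vars J) T)) (mk_prod_X J T)

theorem isUnit_toLoc (J : Ideal (MvPolynomial (Fin (n + 1)) k)) (T : Finset (Fin (n + 1))) :
    IsUnit (toLoc J T (∏ i ∈ T, MvPolynomial.X i)) := by
  rw [toLoc_prod_X]
  exact isUnit_algebraMap_prod (vars J) T

theorem mem_locDeg_iff {J : Ideal (MvPolynomial (Fin (n + 1)) k)} {T : Finset (Fin (n + 1))}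
    {t : ℤ} {z : Loc (vars J) T} : z ∈ locDeg J T t ↔ ∃ (N : ℕ) (a : MvPolynomial (Fin (n + 1)) k),
      IsForm a (t + N * T.card) ∧
      z * toLoc J T (∏ i ∈ T, MvPolynomial.X i) ^ N = toLoc J T a := by
  rw [toLoc_prod_X]
  exact Iff.rfl

theorem exists_frac_toLoc {J : Ideal (MvPolynomial (Fin (n + 1)) k)} {T : Finset (Fin (n + 1))}
    (z : Loc (vars J) T) : ∃ (N : ℕ) (a : MvPolynomial (Fin (n + 1)) k),
      z * toLoc J T (∏ i ∈ T, MvPolynomial.X i) ^ N = toLoc J T a := by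
  obtain ⟨N, a, h⟩ := exists_frac (vars J) T z
  obtain ⟨a, rfl⟩ := Ideal.Quotient.mk_surjective a
  exact ⟨N, a, by rw [toLoc_prod_X]; exact h⟩

/-- Every element of the localization is a sum of homogeneous elements. -/
theorem exists_sum_locDeg {J : Ideal (MvPolynomial (Fin (n + 1)) k)} {T : Finset (Fin (n + 1))}
    (z : Loc (vars J) T) : ∃ (s : Finset ℤ) (w : ℤ → Loc (vars J) T), (∀ t, w t ∈ locDeg J T t) ∧
      z = ∑ t ∈ s, w t := by
  obtain ⟨N, a, ha⟩ := exists_frac_toLoc z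
  obtain ⟨s, b, hb, rfl⟩ := sum_form a
  obtain ⟨u, hu⟩ := (isUnit_toLoc J T).pow N
  refine ⟨s.map (addRightEmbedding (-(N * T.card : ℤ))),
    fun t => toLoc J T (b (t + N * T.card)) * ↑u⁻¹, fun t => ?_, ?_⟩
  · refine mem_locDeg_iff.2 ⟨N, b (t + N * T.card), hb _, ?_⟩
    rw [← hu, mul_assoc, Units.inv_mul, mul_one]
  · rw [Finset.sum_map]
    simp only [addRightEmbedding_apply, neg_add_cancel_right]
    rw [← Finset.sum_mul, ← map_sum, ← ha, ← hu, mul_assoc, Units.mul_inv, mul_one]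

/-- Ideals generated by forms. -/
def GeneratedByForms (J : Ideal (MvPolynomial (Fin (n + 1)) k)) : Prop :=
  ∃ s : Set (MvPolynomial (Fin (n + 1)) k), J = Ideal.span s ∧ ∀ a ∈ s, ∃ e : ℤ, IsForm a e

/-- The coaction of the multiplicative group defining the grading, on polynomials. -/
def coactPoly (J : Ideal (MvPolynomial (Fin (n + 1)) k)) (T : Finset (Fin (n + 1))) :
    MvPolynomial (Fin (n + 1)) k →+* (Loc (vars J) T)[T;T⁻¹] :=
  MvPolynomial.eval₂Hom (C.comp ((toLoc J T).comp MvPolynomial.C))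
    (fun i => C (toLoc J T (MvPolynomial.X i)) * LaurentPolynomial.T 1)

theorem coactPoly_monomial (J : Ideal (MvPolynomial (Fin (n + 1)) k)) (T : Finset (Fin (n + 1)))
    (m : Fin (n + 1) →₀ ℕ) (c : k) : coactPoly J T (MvPolynomial.monomial m c) =
      C (toLoc J T (MvPolynomial.monomial m c)) * LaurentPolynomial.T m.degree := by
  rw [coactPoly, MvPolynomial.coe_eval₂Hom, MvPolynomial.eval₂_monomial, MvPolynomial.monomial_eq,
    map_mul, map_mul, mul_assoc]
  congr 1
  rw [Finsupp.prod, Finsupp.prod, map_prod, map_prod, Finsupp.degree_apply]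
  have : (LaurentPolynomial.T ((∑ i ∈ m.support, m i : ℕ) : ℤ) : (Loc (vars J) T)[T;T⁻¹]) =
      ∏ i ∈ m.support, LaurentPolynomial.T (m i : ℤ) := by
    induction m.support using Finset.induction_on with
    | empty => simp
    | insert a s ha ih => rw [Finset.sum_insert ha, Finset.prod_insert ha, Nat.cast_add, T_add, ih]
  rw [this, ← Finset.prod_mul_distrib]
  refine Finset.prod_congr rfl fun i _ => ?_
  rw [mul_pow, map_pow, map_pow, T_pow, mul_one]

theorem coactPoly_form (J : Ideal (MvPolynomial (Fin (n + 1)) k)) (T : Finset (Fin (n + 1)))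
    {a : MvPolynomial (Fin (n + 1)) k} {t : ℤ} (ha : IsForm a t) :
    coactPoly J T a = C (toLoc J T a) * LaurentPolynomial.T t := by
  have h1 : ∀ m ∈ a.support, coactPoly J T (MvPolynomial.monomial m (a.coeff m)) =
      C (toLoc J T (MvPolynomial.monomial m (a.coeff m))) * LaurentPolynomial.T t := by
    intro m hm
    rw [coactPoly_monomial, isForm_iff.1 ha m (MvPolynomial.mem_support_iff.1 hm)]
  conv_lhs => rw [a.as_sum, map_sum, Finset.sum_congr rfl h1, ← Finset.sum_mul, ← map_sum,
    ← map_sum, ← a.as_sum]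

variable {J : Ideal (MvPolynomial (Fin (n + 1)) k)} (hJ : GeneratedByForms J)
include hJ

/-- On a form the coaction is `toLoc` times a power of the Laurent variable, so it kills the
homogeneous generators of `J` and descends to the quotient. -/
theorem coactPoly_mem (T : Finset (Fin (n + 1))) {a : MvPolynomial (Fin (n + 1)) k} (ha : a ∈ J) :
    coactPoly J T a = 0 := by
  obtain ⟨s, hs, hform⟩ := hJ
  have h1 : J ≤ RingHom.ker (coactPoly J T) := by
    conv_lhs => rw [hs]
    refine Ideal.span_le.2 fun b hb => ?_
    obtain ⟨e, he⟩ := hform b hb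
    have hbJ : b ∈ J := by
      rw [hs]
      exact Ideal.subset_span hb
    change coactPoly J T b = 0
    rw [coactPoly_form J T he, toLoc_apply, Ideal.Quotient.eq_zero_iff_mem.2 hbJ, map_zero,
      map_zero, zero_mul]
  exact h1 ha

/-- The coaction of the multiplicative group defining the grading. -/
def coact (T : Finset (Fin (n + 1))) : Loc (vars J) T →+* (Loc (vars J) T)[T;T⁻¹] :=
  IsLocalization.Away.lift (∏ i ∈ T, vars J i)
    (g := Ideal.Quotient.lift J (coactPoly J T) fun _ => coactPoly_mem hJ T) (by
      have h1 : IsForm (∏ i ∈ T, MvPolynomial.X i : MvPolynomial (Fin (n + 1)) k) T.card := by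
        simpa using isForm_prod_X (k := k) T 1
      have h2 : IsUnit (coactPoly J T (∏ i ∈ T, MvPolynomial.X i)) := by
        rw [coactPoly_form J T h1]
        exact ((isUnit_toLoc J T).map C).mul (isUnit_T _)
      have h3 : ∀ b, b = Ideal.Quotient.mk J (∏ i ∈ T, MvPolynomial.X i) →
          IsUnit (Ideal.Quotient.lift J (coactPoly J T) (fun _ => coactPoly_mem hJ T) b) := by
        rintro _ rfl
        exact h2
      exact h3 _ (mk_prod_X J T).symm)

theorem coact_toLoc (T : Finset (Fin (n + 1))) (a : MvPolynomial (Fin (n + 1)) k) :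
    coact hJ T (toLoc J T a) = coactPoly J T a :=
  IsLocalization.Away.lift_eq _ _ _

theorem coact_of_mem {T : Finset (Fin (n + 1))} {t : ℤ} {z : Loc (vars J) T}
    (hz : z ∈ locDeg J T t) : coact hJ T z = C z * LaurentPolynomial.T t := by
  obtain ⟨N, a, ha, h⟩ := mem_locDeg_iff.1 hz
  have h1 := congrArg (coact hJ T) h
  rw [map_mul, ← map_pow, coact_toLoc, coact_toLoc, coactPoly_form J T (isForm_prod_X T N),
    coactPoly_form J T ha, ← h, map_mul, ← map_pow] at h1
  have h2 : IsUnit (C (toLoc J T ((∏ i ∈ T, MvPolynomial.X i) ^ N)) *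
      LaurentPolynomial.T (N * T.card : ℤ)) := by
    rw [map_pow]
    exact (((isUnit_toLoc J T).pow N).map C).mul (isUnit_T _)
  refine h2.mul_left_injective ?_
  change _ * _ = _ * _
  rw [h1, T_add]
  ring

/-- The projection of a localization of `k[x] / J` to its part of degree `t`. -/
def proj (T : Finset (Fin (n + 1))) (t : ℤ) : Loc (vars J) T →+ Loc (vars J) T where
  toFun z := (coact hJ T z).coeff t
  map_zero' := by rw [map_zero]; rfl
  map_add' a b := by rw [map_add]; rfl

theorem proj_of_mem {T : Finset (Fin (n + 1))} {t : ℤ} {z : Loc (vars J) T}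
    (hz : z ∈ locDeg J T t) : proj hJ T t z = z := by
  change (coact hJ T z).coeff t = z
  rw [coact_of_mem hJ hz, ← single_eq_C_mul_T, AddMonoidAlgebra.coeff_single,
    Finsupp.single_eq_same]

theorem proj_of_mem_ne {T : Finset (Fin (n + 1))} {t t' : ℤ} {z : Loc (vars J) T}
    (hz : z ∈ locDeg J T t) (h : t ≠ t') : proj hJ T t' z = 0 := by
  change (coact hJ T z).coeff t' = 0
  rw [coact_of_mem hJ hz, ← single_eq_C_mul_T, AddMonoidAlgebra.coeff_single,
    Finsupp.single_eq_of_ne h.symm]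

theorem proj_sum {T : Finset (Fin (n + 1))} {s : Finset ℤ} {w : ℤ → Loc (vars J) T}
    (hw : ∀ t, w t ∈ locDeg J T t) (t : ℤ) :
    proj hJ T t (∑ t ∈ s, w t) = if t ∈ s then w t else 0 := by
  rw [map_sum]
  split_ifs with h
  · rw [Finset.sum_eq_single_of_mem t h fun b _ hb => proj_of_mem_ne hJ (hw b) hb,
      proj_of_mem hJ (hw t)]
  · exact Finset.sum_eq_zero fun b hb => proj_of_mem_ne hJ (hw b) fun h' => h (h' ▸ hb)

theorem proj_mem (T : Finset (Fin (n + 1))) (t : ℤ) (z : Loc (vars J) T) :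
    proj hJ T t z ∈ locDeg J T t := by
  obtain ⟨s, w, hw, rfl⟩ := exists_sum_locDeg z
  rw [proj_sum hJ hw]
  split_ifs
  · exact hw t
  · exact AddSubgroup.zero_mem _

theorem exists_sum_proj (T : Finset (Fin (n + 1))) (z : Loc (vars J) T) :
    ∃ s : Finset ℤ, ∀ s', s ⊆ s' → ∑ t ∈ s', proj hJ T t z = z := by
  obtain ⟨s, w, hw, rfl⟩ := exists_sum_locDeg z
  refine ⟨s, fun s' h => ?_⟩
  simp only [proj_sum hJ hw, Finset.sum_ite_mem, Finset.inter_eq_right.2 h]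

/-- An additive map shifting degrees by an injective function commutes with projections. -/
theorem proj_map {J' : Ideal (MvPolynomial (Fin (n + 1)) k)} (hJ' : GeneratedByForms J')
    {T U : Finset (Fin (n + 1))} (φ : Loc (vars J) T →+ Loc (vars J') U) (g : ℤ → ℤ)
    (hg : Function.Injective g) (hφ : ∀ t, ∀ z ∈ locDeg J T t, φ z ∈ locDeg J' U (g t)) (t : ℤ)
    (z : Loc (vars J) T) : proj hJ' U (g t) (φ z) = φ (proj hJ T t z) := by
  obtain ⟨s, w, hw, rfl⟩ := exists_sum_locDeg z
  rw [proj_sum hJ hw, map_sum, map_sum]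
  split_ifs with h
  · rw [Finset.sum_eq_single_of_mem t h fun b _ hb =>
      proj_of_mem_ne hJ' (hφ b _ (hw b)) fun h' => hb (hg h'), proj_of_mem hJ' (hφ t _ (hw t))]
  · rw [map_zero]
    exact Finset.sum_eq_zero fun b hb =>
      proj_of_mem_ne hJ' (hφ b _ (hw b)) fun h' => h (hg h' ▸ hb)

end CI

/-! ### The grading on Čech cochains; differential, multiplication by forms and Frobenius. -/

namespace CI

open Cech

variable {k : Type*} [Field k] {n : ℕ}

theorem mem_cochainDeg {J : Ideal (MvPolynomial (Fin (n + 1)) k)} {q : ℕ} {t : ℤ}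
    {ω : Cochain (vars J) q} : ω ∈ cochainDeg J q t ↔ ∀ T, ω T ∈ locDeg J T.1 t := by
  simp [cochainDeg, AddSubgroup.mem_pi]

theorem mk_smul_loc {J : Ideal (MvPolynomial (Fin (n + 1)) k)} {T : Finset (Fin (n + 1))}
    (s : MvPolynomial (Fin (n + 1)) k) (z : Loc (vars J) T) :
    Ideal.Quotient.mk J s • z = toLoc J T s * z :=
  Algebra.smul_def (R := MvPolynomial (Fin (n + 1)) k ⧸ J) (A := Loc (vars J) T) _ z

theorem mk_smul_mk_smul {J : Ideal (MvPolynomial (Fin (n + 1)) k)} {q : ℕ}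
    (s s' : MvPolynomial (Fin (n + 1)) k) (ω : Cochain (vars J) q) :
    Ideal.Quotient.mk J s • Ideal.Quotient.mk J s' • ω = Ideal.Quotient.mk J (s * s') • ω := by
  rw [map_mul]
  exact (mul_smul (Ideal.Quotient.mk J s) (Ideal.Quotient.mk J s') ω).symm

theorem mk_smul_sub {J : Ideal (MvPolynomial (Fin (n + 1)) k)} {q : ℕ}
    (s : MvPolynomial (Fin (n + 1)) k) (ω η : Cochain (vars J) q) :
    Ideal.Quotient.mk J s • (ω - η) = Ideal.Quotient.mk J s • ω - Ideal.Quotient.mk J s • η :=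
  smul_sub (Ideal.Quotient.mk J s) ω η

theorem mk_smul_of_mem {J : Ideal (MvPolynomial (Fin (n + 1)) k)} {q : ℕ}
    {s : MvPolynomial (Fin (n + 1)) k} (hs : s ∈ J) (ω : Cochain (vars J) q) :
    Ideal.Quotient.mk J s • ω = 0 := by
  rw [Ideal.Quotient.eq_zero_iff_mem.2 hs]
  exact zero_smul (MvPolynomial (Fin (n + 1)) k ⧸ J) ω

theorem res_toLoc (J : Ideal (MvPolynomial (Fin (n + 1)) k)) {T U : Finset (Fin (n + 1))}
    (h : T ⊆ U) (a : MvPolynomial (Fin (n + 1)) k) :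
    res (vars J) h (toLoc J T a) = toLoc J U a := res_algebraMap _ h _

theorem res_mem_locDeg {J : Ideal (MvPolynomial (Fin (n + 1)) k)} {T U : Finset (Fin (n + 1))}
    (h : T ⊆ U) {t : ℤ} {z : Loc (vars J) T} (hz : z ∈ locDeg J T t) :
    res (vars J) h z ∈ locDeg J U t := by
  obtain ⟨N, a, ha, haz⟩ := mem_locDeg_iff.1 hz
  refine mem_locDeg_iff.2 ⟨N, a * (∏ i ∈ U \ T, MvPolynomial.X i) ^ N, ?_, ?_⟩
  · have h1 := ha.mul (isForm_prod_X (k := k) (U \ T) N)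
    have h2 : (U.card : ℤ) = (U \ T).card + T.card := by
      exact_mod_cast (Finset.card_sdiff_add_card_eq_card h).symm
    rwa [show t + N * (T.card : ℤ) + N * ((U \ T).card : ℤ) = t + N * (U.card : ℤ) by
      rw [h2]; ring] at h1
  · have h1 := congrArg (res (vars J) h) haz
    rw [map_mul, map_pow, res_toLoc, res_toLoc] at h1
    have h2 : toLoc J U (∏ i ∈ U, MvPolynomial.X i) =
        toLoc J U (∏ i ∈ U \ T, MvPolynomial.X i) * toLoc J U (∏ i ∈ T, MvPolynomial.X i) := by
      rw [← map_mul, Finset.prod_sdiff h]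
    rw [map_mul, ← h1, h2, map_pow]
    ring

theorem smul_mem_locDeg {J : Ideal (MvPolynomial (Fin (n + 1)) k)} {T : Finset (Fin (n + 1))}
    {h : MvPolynomial (Fin (n + 1)) k} {e t : ℤ} (hh : IsForm h e) {z : Loc (vars J) T}
    (hz : z ∈ locDeg J T t) : Ideal.Quotient.mk J h • z ∈ locDeg J T (t + e) := by
  obtain ⟨N, a, ha, haz⟩ := mem_locDeg_iff.1 hz
  refine mem_locDeg_iff.2 ⟨N, h * a, ?_, ?_⟩
  · have h1 := hh.mul ha
    rwa [show e + (t + N * (T.card : ℤ)) = t + e + N * (T.card : ℤ) by ring] at h1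
  · rw [mk_smul_loc, mul_assoc, haz, map_mul]

theorem pow_mem_locDeg {J : Ideal (MvPolynomial (Fin (n + 1)) k)} {T : Finset (Fin (n + 1))}
    {t : ℤ} {z : Loc (vars J) T} (hz : z ∈ locDeg J T t) (p : ℕ) :
    z ^ p ∈ locDeg J T (p * t) := by
  obtain ⟨N, a, ha, haz⟩ := mem_locDeg_iff.1 hz
  refine mem_locDeg_iff.2 ⟨N * p, a ^ p, ?_, ?_⟩
  · have h1 := ha.pow p
    rw [nsmul_eq_mul] at h1
    convert! h1 using 1
    push_cast
    ring
  · rw [map_pow, ← haz, mul_pow, pow_mul]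

section Projection

variable {J : Ideal (MvPolynomial (Fin (n + 1)) k)} (hJ : GeneratedByForms J)

/-- The projection of Čech cochains to their part of degree `t`. -/
def projCochain (q : ℕ) (t : ℤ) : Cochain (vars J) q →+ Cochain (vars J) q where
  toFun ω T := proj hJ T.1 t (ω T)
  map_zero' := by funext T; simp
  map_add' a b := by funext T; simp

theorem projCochain_apply (q : ℕ) (t : ℤ) (ω : Cochain (vars J) q) (T) :
    projCochain hJ q t ω T = proj hJ T.1 t (ω T) := rfl

theorem projCochain_mem (q : ℕ) (t : ℤ) (ω : Cochain (vars J) q) :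
    projCochain hJ q t ω ∈ cochainDeg J q t :=
  mem_cochainDeg.2 fun T => proj_mem hJ T.1 t (ω T)

theorem projCochain_of_mem {q : ℕ} {t : ℤ} {ω : Cochain (vars J) q} (h : ω ∈ cochainDeg J q t) :
    projCochain hJ q t ω = ω :=
  funext fun T => proj_of_mem hJ (mem_cochainDeg.1 h T)

theorem projCochain_of_mem_ne {q : ℕ} {t t' : ℤ} {ω : Cochain (vars J) q}
    (h : ω ∈ cochainDeg J q t) (htt : t ≠ t') : projCochain hJ q t' ω = 0 :=
  funext fun T => proj_of_mem_ne hJ (mem_cochainDeg.1 h T) htt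

theorem exists_sum_projCochain (q : ℕ) (ω : Cochain (vars J) q) :
    ∃ s : Finset ℤ, ∑ t ∈ s, projCochain hJ q t ω = ω := by
  choose s hs using fun T : {T : Finset (Fin (n + 1)) // T.card = q} =>
    exists_sum_proj hJ T.1 (ω T)
  refine ⟨Finset.univ.biUnion s, funext fun T => ?_⟩
  rw [Finset.sum_apply]
  exact hs T _ (Finset.subset_biUnion_of_mem s (Finset.mem_univ T))

theorem proj_smul_neg_one (T : Finset (Fin (n + 1))) (t : ℤ) (r : ℕ) (z : Loc (vars J) T) :
    proj hJ T t ((-1 : MvPolynomial (Fin (n + 1)) k ⧸ J) ^ r • z) =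
      (-1 : MvPolynomial (Fin (n + 1)) k ⧸ J) ^ r • proj hJ T t z := by
  rcases neg_one_pow_eq_or (MvPolynomial (Fin (n + 1)) k ⧸ J) r with h | h <;> rw [h]
  · exact (congrArg (proj hJ T t) (one_smul (MvPolynomial (Fin (n + 1)) k ⧸ J) z)).trans
      (one_smul (MvPolynomial (Fin (n + 1)) k ⧸ J) (proj hJ T t z)).symm
  · exact (congrArg (proj hJ T t) (neg_one_smul (MvPolynomial (Fin (n + 1)) k ⧸ J) z)).trans
      ((map_neg (proj hJ T t) z).trans
        (neg_one_smul (MvPolynomial (Fin (n + 1)) k ⧸ J) (proj hJ T t z)).symm)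

theorem proj_res {T U : Finset (Fin (n + 1))} (h : T ⊆ U) (t : ℤ) (z : Loc (vars J) T) :
    proj hJ U t (res (vars J) h z) = res (vars J) h (proj hJ T t z) :=
  proj_map hJ hJ (res (vars J) h : Loc (vars J) T →+ Loc (vars J) U) id Function.injective_id
    (fun _ _ hz => res_mem_locDeg h hz) t z

theorem projCochain_d (q : ℕ) (t : ℤ) (ω : Cochain (vars J) q) :
    projCochain hJ (q + 1) t (d (vars J) q ω) = d (vars J) q (projCochain hJ q t ω) := by
  funext T
  rw [projCochain_apply, d_apply, d_apply, map_sum]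
  refine Finset.sum_congr rfl fun i _ => ?_
  rw [proj_smul_neg_one, proj_res]
  rfl

theorem projCochain_smul {h : MvPolynomial (Fin (n + 1)) k} {e : ℤ} (hh : IsForm h e) (q : ℕ)
    (t : ℤ) (ω : Cochain (vars J) q) :
    projCochain hJ q (t + e) (Ideal.Quotient.mk J h • ω) =
      Ideal.Quotient.mk J h • projCochain hJ q t ω :=
  funext fun T => proj_map hJ hJ (DistribSMul.toAddMonoidHom (Loc (vars J) T.1)
    (Ideal.Quotient.mk J h)) (· + e) (add_left_injective e) (fun _ _ hz => smul_mem_locDeg hh hz)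
    t (ω T)

/-- Multiplication by `p` is injective on `ℤ`, so Frobenius does not mix distinct graded components.
-/
theorem projCochain_frob (p : ℕ) [hp : Fact p.Prime] [CharP k p] (q : ℕ) (t : ℤ)
    (ω : Cochain (vars J) q) :
    projCochain hJ q (p * t) (frobCochain (vars J) p (natCast_quot J p) q ω) =
      frobCochain (vars J) p (natCast_quot J p) q (projCochain hJ q t ω) :=
  funext fun T => proj_map hJ hJ (frobHom p (natCast_loc (vars J) (natCast_quot J p) T.1) :
    Loc (vars J) T.1 →+ Loc (vars J) T.1) (p * ·)
    (mul_right_injective₀ (by exact_mod_cast hp.out.ne_zero))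
    (fun _ _ hz => pow_mem_locDeg hz p) t (ω T)

theorem frobCochain_mem_cochainDeg (p : ℕ) [hp : Fact p.Prime] [CharP k p] {q : ℕ} {t : ℤ}
    {ω : Cochain (vars J) q} (h : ω ∈ cochainDeg J q t) :
    frobCochain (vars J) p (natCast_quot J p) q ω ∈ cochainDeg J q (p * t) :=
  mem_cochainDeg.2 fun T => pow_mem_locDeg (mem_cochainDeg.1 h T) p

theorem projCochain_mem_coboundaries {q : ℕ} (t : ℤ) {ω : Cochain (vars J) q}
    (h : ω ∈ coboundaries (vars J) q) : projCochain hJ q t ω ∈ coboundaries (vars J) q := by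
  cases q with
  | zero =>
    have h0 : ω = 0 := h
    rw [h0, map_zero]
    exact Submodule.zero_mem _
  | succ q =>
    obtain ⟨η, rfl⟩ := h
    exact ⟨projCochain hJ q t η, (projCochain_d hJ q t η).symm⟩

end Projection

/-! ### The connecting homomorphism for one regular element. -/

section Step

/-- `J' = J + (h)` with `h` a form of degree `e` that is a nonzerodivisor modulo `J`. -/
structure RegularStep (J J' : Ideal (MvPolynomial (Fin (n + 1)) k))
    (h : MvPolynomial (Fin (n + 1)) k) : Prop where
  eq : J' = J ⊔ Ideal.span {h}
  regular : ∀ s, h * s ∈ J → s ∈ J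

variable {J J' : Ideal (MvPolynomial (Fin (n + 1)) k)} {h : MvPolynomial (Fin (n + 1)) k}

theorem RegularStep.le (H : RegularStep J J' h) : J ≤ J' := H.eq ▸ le_sup_left

/-- The quotient map `k[x] / J → k[x] / J'`. -/
abbrev RegularStep.map (H : RegularStep J J' h) :
    MvPolynomial (Fin (n + 1)) k ⧸ J →+* MvPolynomial (Fin (n + 1)) k ⧸ J' :=
  Ideal.Quotient.factor H.le

theorem RegularStep.map_vars (H : RegularStep J J' h) (i : Fin (n + 1)) :
    H.map (vars J i) = vars J' i := rfl

theorem RegularStep.map_surjective (H : RegularStep J J' h) : Function.Surjective H.map :=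
  Ideal.Quotient.factor_surjective H.le

theorem RegularStep.map_eq_zero_iff (H : RegularStep J J' h) (a : MvPolynomial (Fin (n + 1)) k ⧸ J) :
    H.map a = 0 ↔ ∃ b, a = Ideal.Quotient.mk J h * b := by
  obtain ⟨a, rfl⟩ := Ideal.Quotient.mk_surjective a
  rw [Ideal.Quotient.factor_mk, Ideal.Quotient.eq_zero_iff_mem, H.eq]
  constructor
  · intro ha
    obtain ⟨u, hu, v, hv, rfl⟩ := Submodule.mem_sup.1 ha
    obtain ⟨b, rfl⟩ := Ideal.mem_span_singleton'.1 hv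
    exact ⟨Ideal.Quotient.mk J b, by
      rw [map_add, Ideal.Quotient.eq_zero_iff_mem.2 hu, zero_add, map_mul, mul_comm]⟩
  · rintro ⟨b, hb⟩
    obtain ⟨b, rfl⟩ := Ideal.Quotient.mk_surjective b
    rw [← map_mul, Ideal.Quotient.eq] at hb
    rw [← sub_add_cancel a (h * b)]
    exact Submodule.add_mem_sup hb (Ideal.mul_mem_right _ _ (Ideal.mem_span_singleton_self h))

theorem RegularStep.eq_zero_of_mul (H : RegularStep J J' h)
    (a : MvPolynomial (Fin (n + 1)) k ⧸ J) (ha : Ideal.Quotient.mk J h * a = 0) : a = 0 := by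
  obtain ⟨a, rfl⟩ := Ideal.Quotient.mk_surjective a
  rw [← map_mul, Ideal.Quotient.eq_zero_iff_mem] at ha
  exact Ideal.Quotient.eq_zero_iff_mem.2 (H.regular a ha)

/-- The map of Čech cochains induced by the quotient map. -/
abbrev RegularStep.cochain (H : RegularStep J J' h) (q : ℕ) :
    Cochain (vars J) q →+ Cochain (vars J') q := cochainMap H.map H.map_vars q

theorem RegularStep.cochain_smul (H : RegularStep J J' h) (q : ℕ)
    (s : MvPolynomial (Fin (n + 1)) k) (ω : Cochain (vars J) q) :
    H.cochain q (Ideal.Quotient.mk J s • ω) = Ideal.Quotient.mk J' s • H.cochain q ω :=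
  cochainMap_smul H.map H.map_vars q _ ω

theorem RegularStep.locMap_mem (H : RegularStep J J' h) {T : Finset (Fin (n + 1))} {t : ℤ}
    {z : Loc (vars J) T} (hz : z ∈ locDeg J T t) :
    locMap H.map H.map_vars T z ∈ locDeg J' T t := by
  obtain ⟨N, a, ha, haz⟩ := mem_locDeg_iff.1 hz
  refine mem_locDeg_iff.2 ⟨N, a, ha, ?_⟩
  have h1 := congrArg (locMap H.map H.map_vars T) haz
  rw [map_mul, map_pow] at h1
  exact (congrArg (_ * · ^ N) (locMap_algebraMap H.map H.map_vars T _).symm).trans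
    (h1.trans (locMap_algebraMap H.map H.map_vars T _))

theorem RegularStep.projCochain (H : RegularStep J J' h) (hJ : GeneratedByForms J)
    (hJ' : GeneratedByForms J') (q : ℕ) (t : ℤ) (ω : Cochain (vars J) q) :
    projCochain hJ' q t (H.cochain q ω) = H.cochain q (projCochain hJ q t ω) :=
  funext fun T => proj_map hJ hJ' (locMap H.map H.map_vars T.1 :
    Loc (vars J) T.1 →+ Loc (vars J') T.1) id Function.injective_id
    (fun _ _ hz => H.locMap_mem hz) t (ω T)

theorem RegularStep.frobCochain (H : RegularStep J J' h) (p : ℕ) [Fact p.Prime] [CharP k p] (q : ℕ)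
    (ω : Cochain (vars J) q) :
    H.cochain q (frobCochain (vars J) p (natCast_quot J p) q ω) =
      frobCochain (vars J') p (natCast_quot J' p) q (H.cochain q ω) :=
  funext fun T => map_pow (locMap H.map H.map_vars T.1) (ω T) p

theorem frobCochain_smul (p : ℕ) [Fact p.Prime] [CharP k p] (q : ℕ)
    (s : MvPolynomial (Fin (n + 1)) k) (ω : Cochain (vars J) q) :
    Cech.frobCochain (vars J) p (natCast_quot J p) q (Ideal.Quotient.mk J s • ω) =
      Ideal.Quotient.mk J (s ^ p) • Cech.frobCochain (vars J) p (natCast_quot J p) q ω := by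
  funext T
  change (Ideal.Quotient.mk J s • ω T) ^ p = Ideal.Quotient.mk J (s ^ p) • (ω T) ^ p
  rw [mk_smul_loc, mk_smul_loc, mul_pow, map_pow]

theorem RegularStep.vanishes (H : RegularStep J J' h) {q : ℕ} (hv : Vanishes (vars J) q)
    (hv' : Vanishes (vars J) (q + 1)) : Vanishes (vars J') q :=
  Vanishes.quotient H.map H.map_vars H.map_surjective H.map_eq_zero_iff H.eq_zero_of_mul hv hv'

/-- The connecting map is linear over the polynomial ring. The free scalar `s` records annihilators,
and `s = 1` gives injectivity. -/
theorem RegularStep.mem_iff (H : RegularStep J J' h) {q : ℕ} (hv : Vanishes (vars J) q)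
    {ω : Cochain (vars J) q} {η : Cochain (vars J) (q + 1)}
    (hη : d (vars J) q ω = Ideal.Quotient.mk J h • η) (s : MvPolynomial (Fin (n + 1)) k) :
    Ideal.Quotient.mk J' s • H.cochain q ω ∈ coboundaries (vars J') q ↔
      Ideal.Quotient.mk J s • η ∈ coboundaries (vars J) (q + 1) := by
  rw [← H.cochain_smul]
  refine cochainMap_mem_coboundaries_iff H.map H.map_vars H.map_surjective H.map_eq_zero_iff
    H.eq_zero_of_mul hv ?_
  rw [map_smul, hη, smul_comm]

/-- The connecting homomorphism lowers degrees by `deg h`, is injective and commutes with Frobenius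
up to the factor `h ^ (p - 1)`. -/
theorem RegularStep.exists_connecting (H : RegularStep J J' h) (hJ : GeneratedByForms J)
    (hJ' : GeneratedByForms J') {e : ℤ} (he : IsForm h e) (p : ℕ) [hp : Fact p.Prime] [CharP k p]
    {q : ℕ} (hv : Vanishes (vars J) q) {t : ℤ} {ω : Cochain (vars J') q}
    (hω : d (vars J') q ω = 0) (ht : ω ∈ cochainDeg J' q t) :
    ∃ η : Cochain (vars J) (q + 1), d (vars J) (q + 1) η = 0 ∧ η ∈ cochainDeg J (q + 1) (t - e) ∧
      ∀ s : MvPolynomial (Fin (n + 1)) k,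
        (Ideal.Quotient.mk J' s • ω ∈ coboundaries (vars J') q ↔
          Ideal.Quotient.mk J s • η ∈ coboundaries (vars J) (q + 1)) ∧
        (Ideal.Quotient.mk J' s • Cech.frobCochain (vars J') p (natCast_quot J' p) q ω ∈
            coboundaries (vars J') q ↔
          Ideal.Quotient.mk J (s * h ^ (p - 1)) •
            Cech.frobCochain (vars J) p (natCast_quot J p) (q + 1) η ∈
              coboundaries (vars J) (q + 1)) := by
  obtain ⟨ω', rfl⟩ := cochainMap_surjective H.map H.map_vars H.map_surjective q ω
  -- The lift may be chosen homogeneous of degree `t`.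
  have h0 : H.cochain q (CI.projCochain hJ q t ω') = H.cochain q ω' := by
    rw [← H.projCochain hJ hJ', projCochain_of_mem hJ' ht]
  have hp' : CI.projCochain hJ q t (CI.projCochain hJ q t ω') = CI.projCochain hJ q t ω' :=
    projCochain_of_mem hJ (projCochain_mem hJ q t ω')
  change d (vars J') q (H.cochain q ω') = 0 at hω
  change ∃ η : Cochain (vars J) (q + 1), _ ∧ _ ∧ ∀ s : MvPolynomial (Fin (n + 1)) k,
    (Ideal.Quotient.mk J' s • H.cochain q ω' ∈ _ ↔ _) ∧
    (_ • Cech.frobCochain _ _ _ _ (H.cochain q ω') ∈ _ ↔ _)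
  rw [← h0] at hω ⊢
  generalize CI.projCochain hJ q t ω' = ω at hω hp'
  obtain ⟨η, hη, hdη⟩ := exists_d_eq_smul H.map H.map_vars H.map_eq_zero_iff
    H.eq_zero_of_mul ω hω
  -- `h • η` is homogeneous of degree `t`, and the nonzerodivisor `h` of degree `e` can be
  -- cancelled.
  have hdeg : η ∈ cochainDeg J (q + 1) (t - e) := by
    have h1 := projCochain_smul hJ he (q + 1) (t - e) η
    rw [sub_add_cancel, ← hη, projCochain_d, hp', hη] at h1
    have h2 := smul_cochain_eq_zero H.eq_zero_of_mul (η - CI.projCochain hJ (q + 1) (t - e) η)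
      (by rw [mk_smul_sub, ← h1, sub_self])
    rw [sub_eq_zero.1 h2]
    exact projCochain_mem hJ _ _ _
  refine ⟨η, hdη, hdeg, fun s => ⟨H.mem_iff hv hη s, ?_⟩⟩
  -- Source of the twist: `d (F ω) = F (h • η) = h ^ p • F η`, and the connecting map divides by
  -- only one factor `h`.
  have h3 : d (vars J) q (Cech.frobCochain (vars J) p (natCast_quot J p) q ω) =
      Ideal.Quotient.mk J h • (Ideal.Quotient.mk J (h ^ (p - 1)) •
        Cech.frobCochain (vars J) p (natCast_quot J p) (q + 1) η) := by
    rw [d_frobCochain, hη, frobCochain_smul, mk_smul_mk_smul, ← pow_succ',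
      Nat.sub_add_cancel hp.out.one_le]
  rw [← H.frobCochain, H.mem_iff hv h3, mk_smul_mk_smul]

/-- Surjectivity of the connecting homomorphism onto the classes killed by `h`. -/
theorem RegularStep.exists_of_smul_mem (H : RegularStep J J' h) (hJ : GeneratedByForms J)
    (hJ' : GeneratedByForms J') {e : ℤ} (he : IsForm h e) {q : ℕ} (hv : Vanishes (vars J) q)
    {t : ℤ} {η : Cochain (vars J) (q + 1)}
    (ht : η ∈ cochainDeg J (q + 1) t)
    (hmem : Ideal.Quotient.mk J h • η ∈ coboundaries (vars J) (q + 1)) :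
    ∃ ω : Cochain (vars J') q, d (vars J') q ω = 0 ∧ ω ∈ cochainDeg J' q (t + e) ∧
      ∀ s : MvPolynomial (Fin (n + 1)) k,
        Ideal.Quotient.mk J' s • ω ∈ coboundaries (vars J') q ↔
          Ideal.Quotient.mk J s • η ∈ coboundaries (vars J) (q + 1) := by
  obtain ⟨ν, hν⟩ := hmem
  -- The preimage is the reduction modulo `h` of the degree `t + e` part of a primitive of `h • η`.
  have h1 : d (vars J) q (CI.projCochain hJ q (t + e) ν) = Ideal.Quotient.mk J h • η := by
    rw [← projCochain_d, hν, projCochain_smul hJ he, projCochain_of_mem hJ ht]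
  refine ⟨H.cochain q (CI.projCochain hJ q (t + e) ν), ?_, ?_, H.mem_iff hv h1⟩
  · rw [← cochainMap_d H.map H.map_vars, h1]
    exact (H.cochain_smul (q + 1) h η).trans (mk_smul_of_mem
      (H.eq ▸ Ideal.mem_sup_right (Ideal.mem_span_singleton_self h)) _)
  · rw [← H.projCochain hJ hJ']
    exact projCochain_mem hJ' _ _ _

end Step

end CI

/-! ### Regular sequences and iterated connecting homomorphisms. -/

namespace CI

open Cech

variable {k : Type*} [Field k] {n : ℕ}

/-- The ideal generated by the first `i` members of a sequence. -/
def chain (h : ℕ → MvPolynomial (Fin (n + 1)) k) (i : ℕ) : Ideal (MvPolynomial (Fin (n + 1)) k) :=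
  Ideal.span (h '' Set.Iio i)

theorem chain_zero (h : ℕ → MvPolynomial (Fin (n + 1)) k) : chain h 0 = ⊥ := by
  simp [chain]

theorem chain_succ (h : ℕ → MvPolynomial (Fin (n + 1)) k) (i : ℕ) :
    chain h (i + 1) = chain h i ⊔ Ideal.span {h i} := by
  have : Set.Iio (i + 1) = insert i (Set.Iio i) := by
    ext j
    simp only [Set.mem_Iio, Set.mem_insert_iff]
    omega
  rw [chain, chain, this, Set.image_insert_eq, Ideal.span_insert, sup_comm]

theorem mem_chain (h : ℕ → MvPolynomial (Fin (n + 1)) k) {i j : ℕ} (hij : j < i) :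
    h j ∈ chain h i := Ideal.subset_span ⟨j, hij, rfl⟩

/-- The first `c` members of the sequence `h` form a weakly regular sequence. -/
def RegularChain (h : ℕ → MvPolynomial (Fin (n + 1)) k) (c : ℕ) : Prop :=
  ∀ i < c, ∀ s, h i * s ∈ chain h i → s ∈ chain h i

theorem RegularChain.step {h : ℕ → MvPolynomial (Fin (n + 1)) k} {c : ℕ} (H : RegularChain h c)
    {i : ℕ} (hi : i < c) : RegularStep (chain h i) (chain h (i + 1)) (h i) :=
  ⟨chain_succ h i, H i hi⟩

theorem generatedByForms_chain {h : ℕ → MvPolynomial (Fin (n + 1)) k} {c : ℕ} {e : ℕ → ℤ}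
    (he : ∀ i < c, IsForm (h i) (e i)) {i : ℕ} (hi : i ≤ c) : GeneratedByForms (chain h i) := by
  refine ⟨_, rfl, ?_⟩
  rintro _ ⟨j, hj, rfl⟩
  exact ⟨e j, he j (lt_of_lt_of_le hj hi)⟩

/-- The sequence of the variables, continued by `0`. -/
def varSeq (k : Type*) [Field k] (n : ℕ) (i : ℕ) : MvPolynomial (Fin (n + 1)) k :=
  if h : i < n + 1 then MvPolynomial.X ⟨i, h⟩ else 0

theorem varSeq_image {j : ℕ} (hj : j ≤ n + 1) :
    varSeq k n '' Set.Iio j = MvPolynomial.X '' {i : Fin (n + 1) | i.1 < j} := by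
  ext a
  constructor
  · rintro ⟨i, hi, rfl⟩
    exact ⟨⟨i, lt_of_lt_of_le hi hj⟩, hi, by rw [varSeq, dif_pos]⟩
  · rintro ⟨i, hi, rfl⟩
    exact ⟨i.1, hi, by rw [varSeq, dif_pos i.2]⟩

/-- An ideal generated by variables is detected on monomials, and multiplying by another variable
leaves the exponents of those variables unchanged. -/
theorem regularChain_varSeq : RegularChain (varSeq k n) (n + 1) := by
  intro j hj s hs
  rw [chain, varSeq_image hj.le, MvPolynomial.mem_ideal_span_X_image] at hs ⊢
  intro m hm
  rw [varSeq, dif_pos hj] at hs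
  obtain ⟨i, hi, hmi⟩ := hs (m + Finsupp.single ⟨j, hj⟩ 1) (by
    rw [MvPolynomial.mem_support_iff, add_comm m, MvPolynomial.coeff_X_mul]
    exact MvPolynomial.mem_support_iff.1 hm)
  refine ⟨i, hi, ?_⟩
  have hne : (⟨j, hj⟩ : Fin (n + 1)) ≠ i := fun h => by
    have : i.1 < j := hi
    rw [← h] at this
    exact lt_irrefl _ this
  rwa [Finsupp.add_apply, Finsupp.single_eq_of_ne hne.symm, add_zero] at hmi

/-- Čech cohomology of a polynomial ring vanishes below the top degree. -/
theorem vanishes_chain_zero (h : ℕ → MvPolynomial (Fin (n + 1)) k) {q : ℕ} (hq : q < n + 1) :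
    Vanishes (vars (chain h 0)) q := by
  -- Downward induction on the number `j` of variables set to zero: killing one more variable lowers
  -- the range of vanishing by one, and the range is empty at `j = n + 1`.
  have key : ∀ r j : ℕ, r + j = n + 1 → ∀ q, q + j < n + 1 →
      Vanishes (vars (chain (varSeq k n) j)) q := by
    intro r
    induction r with
    | zero => intro j hj q hq; omega
    | succ r ih =>
      intro j hj q hq
      have hj' : j < n + 1 := by omega
      have H := regularChain_varSeq (k := k) (n := n).step hj'
      have hX : Ideal.Quotient.mk (chain (varSeq k n) j) (varSeq k n j) =
          vars (chain (varSeq k n) j) ⟨j, hj'⟩ := by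
        rw [varSeq, dif_pos hj', vars]
      refine Vanishes.of_quotient H.map H.map_vars H.map_surjective (i := ⟨j, hj'⟩) ?_ ?_
        fun q' hq' => ih (j + 1) (by omega) q' (by omega)
      · rw [← hX]
        exact H.map_eq_zero_iff
      · rw [← hX]
        exact H.eq_zero_of_mul
  have h1 := key (n + 1) 0 rfl q hq
  rw [chain_zero] at h1 ⊢
  exact h1

/-- Each regular element costs one degree of vanishing in the long exact sequence. -/
theorem RegularChain.vanishes {h : ℕ → MvPolynomial (Fin (n + 1)) k} {c : ℕ}
    (H : RegularChain h c) {i : ℕ} (hi : i ≤ c) {q : ℕ} (hq : q + i < n + 1) :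
    Vanishes (vars (chain h i)) q := by
  induction i generalizing q with
  | zero => exact vanishes_chain_zero h hq
  | succ i ih =>
    exact (H.step hi).vanishes (ih (Nat.le_of_succ_le hi) (by omega))
      (ih (Nat.le_of_succ_le hi) (by omega))

/-- The iterated connecting homomorphism embeds `H^{n + 1 - i}` of the quotient by a regular
sequence into the top cohomology of the polynomial ring. -/
theorem RegularChain.exists_top {h : ℕ → MvPolynomial (Fin (n + 1)) k} {c : ℕ}
    (H : RegularChain h c) {e : ℕ → ℤ} (he : ∀ i < c, IsForm (h i) (e i)) (p : ℕ)
    [hp : Fact p.Prime] [CharP k p] {i : ℕ} (hi : i ≤ c) {q : ℕ} (hq : q + i = n + 1) {t : ℤ}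
    {ω : Cochain (vars (chain h i)) q} (hω : d (vars (chain h i)) q ω = 0)
    (ht : ω ∈ cochainDeg (chain h i) q t) :
    ∃ η : Cochain (vars (chain h 0)) (n + 1),
      η ∈ cochainDeg (chain h 0) (n + 1) (t - ∑ j ∈ Finset.range i, e j) ∧
      ∀ s : MvPolynomial (Fin (n + 1)) k,
        (Ideal.Quotient.mk (chain h i) s • ω ∈ coboundaries (vars (chain h i)) q ↔
          Ideal.Quotient.mk (chain h 0) s • η ∈ coboundaries (vars (chain h 0)) (n + 1)) ∧
        (Ideal.Quotient.mk (chain h i) s •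
            frobCochain (vars (chain h i)) p (natCast_quot (chain h i) p) q ω ∈
            coboundaries (vars (chain h i)) q ↔
          Ideal.Quotient.mk (chain h 0) (s * (∏ j ∈ Finset.range i, h j) ^ (p - 1)) •
            frobCochain (vars (chain h 0)) p (natCast_quot (chain h 0) p) (n + 1) η ∈
              coboundaries (vars (chain h 0)) (n + 1)) := by
  induction i generalizing q t with
  | zero =>
    obtain rfl : q = n + 1 := hq
    exact ⟨ω, by simpa using ht, fun s => by simp⟩
  | succ i ih =>
    obtain ⟨η', hdη', hη't, hη'⟩ := (H.step hi).exists_connecting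
      (generatedByForms_chain he (Nat.le_of_succ_le hi)) (generatedByForms_chain he hi)
      (he i hi) p (H.vanishes (Nat.le_of_succ_le hi) (by omega)) hω ht
    obtain ⟨η, hηt, hη⟩ := ih (Nat.le_of_succ_le hi) (by omega) hdη' hη't
    -- For the Frobenius equivalence the induction hypothesis is used with the scalar `s * h i ^ (p
    -- - 1)`; this is why `s` stays universally quantified.
    refine ⟨η, ?_, fun s => ⟨(hη' s).1.trans (hη s).1, (hη' s).2.trans ((hη _).2.trans ?_)⟩⟩
    · rwa [Finset.sum_range_succ, add_comm (∑ j ∈ Finset.range i, e j), ← sub_sub]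
    · rw [Finset.prod_range_succ, mul_pow, mul_assoc, mul_comm (h i ^ (p - 1))]

/-- The iterated connecting homomorphism is surjective onto the classes killed by the regular
sequence. -/
theorem RegularChain.exists_of_top {h : ℕ → MvPolynomial (Fin (n + 1)) k} {c : ℕ}
    (H : RegularChain h c) {e : ℕ → ℤ} (he : ∀ i < c, IsForm (h i) (e i)) {i : ℕ} (hi : i ≤ c)
    {q : ℕ} (hq : q + i = n + 1) {t : ℤ} {η : Cochain (vars (chain h 0)) (n + 1)}
    (ht : η ∈ cochainDeg (chain h 0) (n + 1) t)
    (hmem : ∀ j < i, Ideal.Quotient.mk (chain h 0) (h j) • η ∈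
      coboundaries (vars (chain h 0)) (n + 1)) :
    ∃ ω : Cochain (vars (chain h i)) q,
      ω ∈ cochainDeg (chain h i) q (t + ∑ j ∈ Finset.range i, e j) ∧
      ∀ s : MvPolynomial (Fin (n + 1)) k,
        Ideal.Quotient.mk (chain h i) s • ω ∈ coboundaries (vars (chain h i)) q ↔
          Ideal.Quotient.mk (chain h 0) s • η ∈ coboundaries (vars (chain h 0)) (n + 1) := by
  induction i generalizing q with
  | zero =>
    obtain rfl : q = n + 1 := hq
    exact ⟨η, by simpa using ht, fun s => Iff.rfl⟩
  | succ i ih =>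
    obtain ⟨η', hη't, hη'⟩ := ih (q := q + 1) (Nat.le_of_succ_le hi) (by omega)
      fun j hj => hmem j (Nat.lt_succ_of_lt hj)
    obtain ⟨ω, -, hωt, hω⟩ := (H.step hi).exists_of_smul_mem
      (generatedByForms_chain he (Nat.le_of_succ_le hi)) (generatedByForms_chain he hi)
      (he i hi) (H.vanishes (Nat.le_of_succ_le hi) (by omega)) hη't
      ((hη' _).2 (hmem i (Nat.lt_succ_self i)))
    refine ⟨ω, ?_, fun s => (hω s).trans (hη' s)⟩
    rwa [Finset.sum_range_succ, ← add_assoc]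

/-- Cochains of degree `0` have no part of negative degree. -/
theorem eq_zero_of_mem_cochainDeg_zero {J : Ideal (MvPolynomial (Fin (n + 1)) k)} {t : ℤ}
    (ht : t < 0) {ω : Cochain (vars J) 0} (h : ω ∈ cochainDeg J 0 t) : ω = 0 := by
  funext T
  obtain ⟨N, a, ha, haz⟩ := mem_locDeg_iff.1 (mem_cochainDeg.1 h T)
  rw [T.2, Nat.cast_zero, mul_zero, add_zero] at ha
  rw [ha.eq_zero_of_neg ht, map_zero] at haz
  exact (((isUnit_toLoc J T.1).pow N).mul_left_eq_zero).1 haz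

/-! ### Top Čech cohomology of the polynomial ring. -/

/-- The ideal generated by the `m`-th powers of the variables. -/
def powIdeal (k : Type*) [Field k] (n m : ℕ) : Ideal (MvPolynomial (Fin (n + 1)) k) :=
  Ideal.span (Set.range fun i => MvPolynomial.X i ^ m)

theorem mem_powIdeal {m : ℕ} {a : MvPolynomial (Fin (n + 1)) k} :
    a ∈ powIdeal k n m ↔ ∀ μ ∈ a.support, ∃ i, m ≤ μ i := by
  have h1 : powIdeal k n m = Ideal.span ((fun s => MvPolynomial.monomial s (1 : k)) ''
      Set.range fun i => Finsupp.single i m) := by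
    rw [powIdeal, ← Set.range_comp]
    congr 2
    funext i
    exact (MvPolynomial.X_pow_eq_monomial)
  rw [h1, MvPolynomial.mem_ideal_span_monomial_image]
  simp

/-- Multiplication by `(∏ x_i) ^ M` raises every exponent by `M`. Cohomologically, the transition
maps `S/(x_i^m) → S/(x_i^(m+M))` are injective. -/
theorem mem_powIdeal_of_prod_pow_mul {m M : ℕ} {a : MvPolynomial (Fin (n + 1)) k}
    (h : (∏ i, MvPolynomial.X i) ^ M * a ∈ powIdeal k n (m + M)) : a ∈ powIdeal k n m := by
  rw [mem_powIdeal] at h ⊢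
  intro μ hμ
  have hX : (∏ i, MvPolynomial.X i : MvPolynomial (Fin (n + 1)) k) ^ M =
      MvPolynomial.monomial (Finsupp.equivFunOnFinite.symm fun _ => M) 1 := by
    rw [MvPolynomial.monomial_eq, map_one, one_mul, ← Finset.prod_pow,
      Finsupp.prod_fintype _ _ fun i => pow_zero _]
    rfl
  obtain ⟨i, hi⟩ := h ((Finsupp.equivFunOnFinite.symm fun _ => M) + μ) (by
    rw [MvPolynomial.mem_support_iff, hX, MvPolynomial.coeff_monomial_mul, one_mul]
    exact MvPolynomial.mem_support_iff.1 hμ)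
  refine ⟨i, ?_⟩
  simp only [Finsupp.add_apply, Finsupp.equivFunOnFinite_symm_apply_apply] at hi
  omega

end CI

namespace CI

open Cech

variable {k : Type*} [Field k] {n : ℕ}

/-- The hypothesis `J = ⊥` in place of a literal `⊥` allows the use with `chain h 0`. -/
theorem toLoc_injective {J : Ideal (MvPolynomial (Fin (n + 1)) k)} (hJ : J = ⊥)
    (T : Finset (Fin (n + 1))) : Function.Injective (toLoc J T) := by
  rw [injective_iff_map_eq_zero]
  intro a ha
  obtain ⟨N, hN⟩ := (algebraMap_eq_zero_iff' (vars J) T (Ideal.Quotient.mk J a)).1 ha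
  rw [← mk_prod_X, ← map_pow, ← map_mul, Ideal.Quotient.eq_zero_iff_mem, hJ, Ideal.mem_bot] at hN
  exact (mul_eq_zero.1 hN).resolve_left
    (pow_ne_zero _ (Finset.prod_ne_zero_iff.2 fun i _ => MvPolynomial.X_ne_zero i))

theorem neg_one_pow_smul_loc {J : Ideal (MvPolynomial (Fin (n + 1)) k)}
    {T : Finset (Fin (n + 1))} (r : ℕ) (z : Loc (vars J) T) :
    (-1 : MvPolynomial (Fin (n + 1)) k ⧸ J) ^ r • z = toLoc J T ((-1) ^ r) * z := by
  rw [← mk_smul_loc, map_pow, map_neg, map_one]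

/-- The set of all variables, as an index of the top Čech cochains. -/
def topIndex (n : ℕ) : {T : Finset (Fin (n + 1)) // T.card = n + 1} :=
  ⟨Finset.univ, by simp⟩

theorem eq_topIndex (T : {T : Finset (Fin (n + 1)) // T.card = n + 1}) : T = topIndex n :=
  Subtype.ext ((Finset.card_eq_iff_eq_univ T.1).1 (by simpa using T.2))

/-- The only component of a top Čech cochain. -/
def topValue {J : Ideal (MvPolynomial (Fin (n + 1)) k)} (η : Cochain (vars J) (n + 1)) :
    Loc (vars J) Finset.univ := η (topIndex n)

theorem topValue_injective {J : Ideal (MvPolynomial (Fin (n + 1)) k)} :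
    Function.Injective (topValue (J := J)) := by
  intro η ν h
  funext T
  rw [eq_topIndex T]
  exact h

theorem toLoc_prod_univ_pow (J : Ideal (MvPolynomial (Fin (n + 1)) k)) (j : Fin (n + 1)) (m : ℕ) :
    toLoc J Finset.univ (∏ i, MvPolynomial.X i) ^ m =
      toLoc J Finset.univ (MvPolynomial.X j ^ m) *
        toLoc J Finset.univ (∏ i ∈ Finset.univ.erase j, MvPolynomial.X i) ^ m := by
  rw [← Finset.mul_prod_erase Finset.univ MvPolynomial.X (Finset.mem_univ j), ← map_pow, ← map_pow,
    ← map_mul, mul_pow]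

theorem res_mul_prod_univ_pow {J : Ideal (MvPolynomial (Fin (n + 1)) k)} {j : Fin (n + 1)} {m : ℕ}
    {z : Loc (vars J) (Finset.univ.erase j)} {a : MvPolynomial (Fin (n + 1)) k}
    (h : z * toLoc J (Finset.univ.erase j) (∏ i ∈ Finset.univ.erase j, MvPolynomial.X i) ^ m =
      toLoc J (Finset.univ.erase j) a) :
    res (vars J) (Finset.erase_subset j Finset.univ) z *
        toLoc J Finset.univ (∏ i, MvPolynomial.X i) ^ m =
      toLoc J Finset.univ (a * MvPolynomial.X j ^ m) := by
  have h1 := congrArg (res (vars J) (Finset.erase_subset j Finset.univ)) h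
  rw [map_mul, map_pow, res_toLoc, res_toLoc] at h1
  rw [toLoc_prod_univ_pow J j, map_mul, ← h1]
  ring

theorem topValue_d {J : Ideal (MvPolynomial (Fin (n + 1)) k)} (ω : Cochain (vars J) n) :
    topValue (d (vars J) n ω) = ∑ j, toLoc J Finset.univ ((-1) ^ pos Finset.univ j) *
      res (vars J) (Finset.erase_subset j Finset.univ)
        (ω ⟨Finset.univ.erase j, by simp⟩) := by
  rw [topValue, d_apply]
  refine Fintype.sum_equiv (Equiv.subtypeUnivEquiv fun i => Finset.mem_univ i) _ _ fun i => ?_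
  exact neg_one_pow_smul_loc _ _

/-- This is the equation saying that `g / (∏ x_i) ^ m` is a coboundary, after clearing denominators;
each summand on the right is divisible by some `x_j ^ (m + M)`. -/
theorem mem_powIdeal_of_eq {m M : ℕ} {g : MvPolynomial (Fin (n + 1)) k}
    (a : Fin (n + 1) → MvPolynomial (Fin (n + 1)) k)
    (h : (∏ i, MvPolynomial.X i) ^ M * g =
      (∏ i, MvPolynomial.X i) ^ m * ∑ j, a j * MvPolynomial.X j ^ M) : g ∈ powIdeal k n m := by
  refine mem_powIdeal_of_prod_pow_mul (M := M) ?_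
  rw [h, Finset.mul_sum]
  refine Ideal.sum_mem _ fun j _ => ?_
  rw [← Finset.mul_prod_erase Finset.univ MvPolynomial.X (Finset.mem_univ j), mul_pow]
  have : (MvPolynomial.X j ^ m * (∏ i ∈ Finset.univ.erase j, MvPolynomial.X i) ^ m *
      (a j * MvPolynomial.X j ^ M) : MvPolynomial (Fin (n + 1)) k) =
      (∏ i ∈ Finset.univ.erase j, MvPolynomial.X i) ^ m * a j * MvPolynomial.X j ^ (m + M) := by
    ring
  rw [this]
  exact Ideal.mul_mem_left _ _ (Ideal.subset_span ⟨j, rfl⟩)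

/-- The class of `g / (x_0 ⋯ x_n) ^ m` in top Čech cohomology vanishes if and only if `g` lies in
the ideal generated by the `x_i ^ m`. -/
theorem mem_coboundaries_top_iff {J : Ideal (MvPolynomial (Fin (n + 1)) k)} (hJ : J = ⊥)
    {η : Cochain (vars J) (n + 1)} {m : ℕ} {g : MvPolynomial (Fin (n + 1)) k}
    (h : topValue η * toLoc J Finset.univ (∏ i, MvPolynomial.X i) ^ m =
      toLoc J Finset.univ g) :
    η ∈ coboundaries (vars J) (n + 1) ↔ g ∈ powIdeal k n m := by
  constructor
  · rintro ⟨ω, rfl⟩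
    choose N₀ hN₀ using fun j : Fin (n + 1) => exists_frac_ge (vars J) (Finset.univ.erase j)
      (ω ⟨Finset.univ.erase j, by simp⟩)
    obtain ⟨M, hM⟩ := (Set.finite_range N₀).bddAbove
    have h1 : ∀ j : Fin (n + 1), ∃ a : MvPolynomial (Fin (n + 1)) k,
        ω ⟨Finset.univ.erase j, by simp⟩ *
          toLoc J (Finset.univ.erase j) (∏ i ∈ Finset.univ.erase j, MvPolynomial.X i) ^ M =
        toLoc J (Finset.univ.erase j) a := by
      intro j
      obtain ⟨a, ha⟩ := hN₀ j M (hM ⟨j, rfl⟩)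
      obtain ⟨a, rfl⟩ := Ideal.Quotient.mk_surjective a
      exact ⟨a, by rw [toLoc_prod_X]; exact ha⟩
    choose a ha using h1
    -- `M` is a common denominator exponent for all components of the primitive.
    refine mem_powIdeal_of_eq (M := M)
      (fun j => (-1) ^ pos Finset.univ j * a j) (toLoc_injective hJ Finset.univ ?_)
    rw [map_mul, ← h, map_pow, map_mul, map_pow, topValue_d, map_sum, mul_left_comm, mul_comm,
      mul_right_comm, mul_comm (toLoc J Finset.univ _ ^ M), Finset.sum_mul, mul_comm]
    congr 1
    refine Finset.sum_congr rfl fun j _ => ?_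
    rw [mul_assoc, res_mul_prod_univ_pow (ha j), ← map_mul, mul_assoc]
  · intro hg
    obtain ⟨c, rfl⟩ := Ideal.mem_span_range_iff_exists_fun.1 hg
    have h1 : ∀ (i : Fin (n + 1)) (U : Finset (Fin (n + 1))), ∃ w : Loc (vars J) U,
        w * toLoc J U (∏ i ∈ U, MvPolynomial.X i) ^ m = toLoc J U (c i) := by
      intro i U
      obtain ⟨u, hu⟩ := (isUnit_toLoc J U).pow m
      exact ⟨toLoc J U (c i) * ↑u⁻¹, by rw [← hu, mul_assoc, Units.inv_mul, mul_one]⟩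
    choose w hw using h1
    -- Each `U` omits exactly one index, so the sum has a single term `± c_i / (∏_{j ≠ i} x_j) ^ m`;
    -- the sign cancels the one in the differential.
    let ω : Cochain (vars J) n := fun U => ∑ i ∈ Finset.univ \ U.1,
      toLoc J U.1 ((-1) ^ pos Finset.univ i) * w i U.1
    refine ⟨ω, topValue_injective (((isUnit_toLoc J Finset.univ).pow m).mul_left_injective ?_)⟩
    change topValue (d (vars J) n ω) * _ = topValue η * _
    rw [h, topValue_d, Finset.sum_mul, map_sum]
    refine Finset.sum_congr rfl fun j _ => ?_
    have h2 : (Finset.univ \ Finset.univ.erase j : Finset (Fin (n + 1))) = {j} := by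
      ext i
      simp
    have h3 : ((-1) ^ pos Finset.univ j * (-1) ^ pos Finset.univ j :
        MvPolynomial (Fin (n + 1)) k) = 1 := by
      rw [← pow_add, Even.neg_one_pow ⟨_, rfl⟩]
    have h4 : ω ⟨Finset.univ.erase j, by simp⟩ = toLoc J (Finset.univ.erase j)
        ((-1) ^ pos Finset.univ j) * w j (Finset.univ.erase j) := by
      change ∑ i ∈ Finset.univ \ Finset.univ.erase j, _ = _
      rw [h2, Finset.sum_singleton]
    rw [h4]
    rw [map_mul, res_toLoc, ← mul_assoc, ← map_mul, h3, map_one, one_mul,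
      res_mul_prod_univ_pow (hw j _)]

theorem mk_smul_mem_coboundaries_top_iff {J : Ideal (MvPolynomial (Fin (n + 1)) k)} (hJ : J = ⊥)
    {η : Cochain (vars J) (n + 1)} {m : ℕ} {g : MvPolynomial (Fin (n + 1)) k}
    (h : topValue η * toLoc J Finset.univ (∏ i, MvPolynomial.X i) ^ m =
      toLoc J Finset.univ g) (s : MvPolynomial (Fin (n + 1)) k) :
    Ideal.Quotient.mk J s • η ∈ coboundaries (vars J) (n + 1) ↔ s * g ∈ powIdeal k n m := by
  refine mem_coboundaries_top_iff hJ ?_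
  rw [map_mul, ← h, ← mul_assoc]
  exact congrArg (· * _) (mk_smul_loc s (topValue η))

/-- A top cochain of degree `t` with numerator `g` over `(x_0 ⋯ x_n) ^ m`. -/
theorem exists_top_cochain (J : Ideal (MvPolynomial (Fin (n + 1)) k)) {t : ℤ} {m : ℕ}
    {g : MvPolynomial (Fin (n + 1)) k} (hg : IsForm g (t + m * (n + 1))) :
    ∃ η ∈ cochainDeg J (n + 1) t,
      topValue η * toLoc J Finset.univ (∏ i, MvPolynomial.X i) ^ m =
        toLoc J Finset.univ g := by
  have h1 : ∀ U : Finset (Fin (n + 1)), ∃ w : Loc (vars J) U,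
      w * toLoc J U (∏ i ∈ U, MvPolynomial.X i) ^ m = toLoc J U g := by
    intro U
    obtain ⟨u, hu⟩ := (isUnit_toLoc J U).pow m
    exact ⟨toLoc J U g * ↑u⁻¹, by rw [← hu, mul_assoc, Units.inv_mul, mul_one]⟩
  choose w hw using h1
  refine ⟨fun U => w U.1, mem_cochainDeg.2 fun T => mem_locDeg_iff.2 ⟨m, g, ?_, hw _⟩, hw _⟩
  rw [T.2]
  exact_mod_cast hg

end CI

/-! ### Extending regular sequences over infinite fields, and the degree bound. -/

namespace CI

open Cech

variable {k : Type*} [Field k] {n : ℕ}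

theorem algebraMap_loc_empty_injective {J : Ideal (MvPolynomial (Fin (n + 1)) k)}
    {T : Finset (Fin (n + 1))} (hT : T.card = 0) (a : MvPolynomial (Fin (n + 1)) k ⧸ J)
    (ha : algebraMap _ (Loc (vars J) T) a = 0) : a = 0 := by
  obtain rfl := Finset.card_eq_zero.1 hT
  obtain ⟨N, hN⟩ := (algebraMap_eq_zero_iff' (vars J) ∅ a).1 ha
  simpa using hN

/-- If `H^0_𝔪(R) = 0` then no nonzero element of `R` is killed by all variables. -/
theorem eq_zero_of_vars_mul_eq_zero {J : Ideal (MvPolynomial (Fin (n + 1)) k)}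
    (hv : Vanishes (vars J) 0) (a : MvPolynomial (Fin (n + 1)) k ⧸ J)
    (ha : ∀ i, vars J i * a = 0) : a = 0 := by
  -- An element killed by all variables dies in every nontrivial localization, so it defines a Čech
  -- cocycle of degree `0`.
  have h1 : (fun T => algebraMap _ (Loc (vars J) T.1) a : Cochain (vars J) 0) = 0 := by
    refine hv _ (funext fun T => ?_)
    rw [d_apply]
    refine Finset.sum_eq_zero fun i _ => ?_
    have h2 : algebraMap _ (Loc (vars J) T.1) a = 0 := by
      refine ((isUnit_algebraMap_mem (vars J) i.2).mul_right_eq_zero).1 ?_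
      rw [← map_mul, ha, map_zero]
    rw [neg_one_pow_smul_loc, res_algebraMap, h2, mul_zero]
  exact algebraMap_loc_empty_injective Finset.card_empty a (congrFun h1 ⟨∅, rfl⟩)

/-- Prime avoidance: a subspace generating, together with `J`, an ideal whose radical contains all
variables contains a nonzerodivisor modulo `J`, if `H^0_𝔪` vanishes. -/
theorem exists_regular_mem [Infinite k] {J : Ideal (MvPolynomial (Fin (n + 1)) k)}
    (hv : Vanishes (vars J) 0) (V : Submodule k (MvPolynomial (Fin (n + 1)) k))
    (hV : ∀ i, MvPolynomial.X i ∈ (J ⊔ Ideal.span (V : Set (MvPolynomial (Fin (n + 1)) k))).radical) :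
    ∃ ℓ ∈ V, ∀ s, ℓ * s ∈ J → s ∈ J := by
  have hfin := associatedPrimes.finite (MvPolynomial (Fin (n + 1)) k ⧸ J)
    (MvPolynomial (Fin (n + 1)) k ⧸ J)
  let W : Ideal (MvPolynomial (Fin (n + 1)) k ⧸ J) → Subspace k V := fun P =>
    ((P.comap (Ideal.Quotient.mk J)).restrictScalars k).comap V.subtype
  have hW : ∀ P ∈ associatedPrimes (MvPolynomial (Fin (n + 1)) k ⧸ J)
      (MvPolynomial (Fin (n + 1)) k ⧸ J), W P ≠ ⊤ := by
    intro P hP htop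
    obtain ⟨hprime, a, hPa⟩ := isAssociatedPrime_iff.1 hP
    have hle : J ⊔ Ideal.span (V : Set (MvPolynomial (Fin (n + 1)) k)) ≤
        P.comap (Ideal.Quotient.mk J) := by
      refine sup_le (fun b hb => ?_) (Ideal.span_le.2 fun b hb => ?_)
      · rw [Ideal.mem_comap, Ideal.Quotient.eq_zero_iff_mem.2 hb]
        exact P.zero_mem
      · have h1 : (⟨b, hb⟩ : V) ∈ W P := htop ▸ Submodule.mem_top
        exact h1
    -- An associated prime containing `V` contains all variables, so the element it annihilates is
    -- zero by the vanishing of `H^0`, which is absurd.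
    have hX : ∀ i, vars J i ∈ P := fun i =>
      ((hprime.comap (Ideal.Quotient.mk J)).isRadical.radical_le_iff.2 hle) (hV i)
    have ha : a = 0 := eq_zero_of_vars_mul_eq_zero hv a fun i => by
      have h1 := hX i
      rw [hPa] at h1
      simpa using h1
    refine hprime.ne_top ?_
    rw [hPa, ha]
    simp
  have h1 : (⊤ : Subspace k V) ∉ hfin.toFinset.image W := by
    intro h
    obtain ⟨P, hP, hPW⟩ := Finset.mem_image.1 h
    exact hW P (hfin.mem_toFinset.1 hP) hPW
  -- A vector space over an infinite field is not a finite union of proper subspaces.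
  obtain ⟨ℓ, hℓ⟩ := (Set.ne_univ_iff_exists_notMem _).1
    (Subspace.biUnion_ne_univ_of_top_notMem h1)
  refine ⟨ℓ.1, ℓ.2, fun s hs => ?_⟩
  have h2 : Ideal.Quotient.mk J ℓ.1 ∈ nonZeroDivisors (MvPolynomial (Fin (n + 1)) k ⧸ J) := by
    by_contra h3
    have h4 : Ideal.Quotient.mk J ℓ.1 ∈
        ((nonZeroDivisors (MvPolynomial (Fin (n + 1)) k ⧸ J) : Set _)ᶜ) := h3
    rw [← biUnion_associatedPrimes_eq_compl_nonZeroDivisors] at h4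
    obtain ⟨P, hP, hmem⟩ := Set.mem_iUnion₂.1 h4
    exact hℓ (Set.mem_iUnion₂.2 ⟨W P, Finset.mem_image_of_mem W (hfin.mem_toFinset.2 hP), hmem⟩)
  rw [← Ideal.Quotient.eq_zero_iff_mem] at hs ⊢
  rw [map_mul, mul_comm] at hs
  exact (mem_nonZeroDivisors_iff_right.1 h2) _ hs

theorem chain_congr {h h' : ℕ → MvPolynomial (Fin (n + 1)) k} {i : ℕ} (hh : ∀ j < i, h j = h' j) :
    chain h i = chain h' i := by
  have : h '' Set.Iio i = h' '' Set.Iio i := Set.image_congr fun j hj => hh j hj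
  rw [chain, this, chain]

/-- A regular sequence can be extended to length `n + 1` inside a subspace which together with it
generates an ideal whose radical contains all variables. -/
theorem RegularChain.extend [Infinite k] {h : ℕ → MvPolynomial (Fin (n + 1)) k} {c : ℕ}
    (H : RegularChain h c) (V : Submodule k (MvPolynomial (Fin (n + 1)) k))
    (hV : ∀ i, MvPolynomial.X i ∈
      (chain h c ⊔ Ideal.span (V : Set (MvPolynomial (Fin (n + 1)) k))).radical)
    (r : ℕ) (hr : c + r ≤ n + 1) : ∃ h' : ℕ → MvPolynomial (Fin (n + 1)) k,
      (∀ j < c, h' j = h j) ∧ (∀ j, c ≤ j → h' j ∈ V) ∧ RegularChain h' (c + r) := by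
  induction r with
  | zero =>
    -- Terms from index `c` on only have to lie in `V` at this stage, so `0` serves as filler.
    refine ⟨fun j => if j < c then h j else 0, fun j hj => if_pos hj, fun j hj => ?_, ?_⟩
    · simp only [if_neg (not_lt.2 hj)]
      exact V.zero_mem
    · intro i hi s hs
      have h1 : chain (fun j => if j < c then h j else 0) i = chain h i :=
        chain_congr fun j hj => if_pos (hj.trans hi)
      have h2 : (fun j => if j < c then h j else 0) i = h i := if_pos hi
      rw [h1, h2] at hs
      rw [h1]
      exact H i hi s hs
  | succ r ih =>
    obtain ⟨h', h1, h2, h3⟩ := ih (by omega)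
    -- `H^0` of the quotient vanishes as long as fewer than `n + 1` elements have been used.
    obtain ⟨ℓ, hℓ, hreg⟩ := exists_regular_mem (h3.vanishes (q := 0) le_rfl (by omega)) V
      fun i => Ideal.radical_mono (sup_le_sup_right (by
        rw [← chain_congr h1]
        exact Ideal.span_mono (Set.image_mono (Set.Iio_subset_Iio (by omega)))) _) (hV i)
    have h4 : ∀ j, j ≠ c + r → Function.update h' (c + r) ℓ j = h' j := fun j hj =>
      Function.update_of_ne hj _ _
    refine ⟨Function.update h' (c + r) ℓ, fun j hj => ?_, fun j hj => ?_, fun i hi s hs => ?_⟩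
    · rw [h4 j (by omega), h1 j hj]
    · by_cases hjc : j = c + r
      · rw [hjc, Function.update_self]
        exact hℓ
      · rw [h4 j hjc]
        exact h2 j hj
    · rw [chain_congr (h' := h') fun j hj => h4 j (by omega)] at hs ⊢
      by_cases hic : i = c + r
      · subst hic
        rw [Function.update_self] at hs
        exact hreg s hs
      · rw [h4 i hic] at hs
        exact h3 i (by omega) s hs

/-- A form of small degree in the colon of `(x_i ^ L)` by a regular sequence and further forms, which
generate an ideal whose radical contains all variables, lies in `(x_i ^ L)`. -/
theorem RegularChain.mem_powIdeal_of_infinite [Infinite k]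
    {h : ℕ → MvPolynomial (Fin (n + 1)) k} {c : ℕ} (H : RegularChain h c) (hc : c ≤ n + 1)
    {e : ℕ → ℤ} (he : ∀ i < c, IsForm (h i) (e i)) {M : Set (MvPolynomial (Fin (n + 1)) k)}
    {δ : ℤ} (hM : ∀ a ∈ M, IsForm a δ)
    (hrad : ∀ i, MvPolynomial.X i ∈ (chain h c ⊔ Ideal.span M).radical) {L : ℕ} {u : ℤ}
    {g : MvPolynomial (Fin (n + 1)) k} (hg : IsForm g u)
    (hu : u + ∑ j ∈ Finset.range c, e j + (n + 1 - c) * δ < L * (n + 1))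
    (hhg : ∀ j < c, h j * g ∈ powIdeal k n L) (hMg : ∀ a ∈ M, a * g ∈ powIdeal k n L) :
    g ∈ powIdeal k n L := by
  let V := Submodule.span k M
  have hVδ : ∀ a ∈ V, IsForm a δ := fun a ha =>
    (Submodule.span_le (p := MvPolynomial.weightedHomogeneousSubmodule k _ δ)).2 hM ha
  have hVg : ∀ a ∈ V, a * g ∈ powIdeal k n L := by
    intro a ha
    refine Submodule.span_induction (p := fun a _ => a * g ∈ powIdeal k n L) hMg ?_ ?_ ?_ ha
    · rw [zero_mul]
      exact Ideal.zero_mem _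
    · intro a b _ _ ha hb
      rw [add_mul]
      exact Ideal.add_mem _ ha hb
    · intro r a _ ha
      rw [MvPolynomial.smul_eq_C_mul, mul_assoc]
      exact Ideal.mul_mem_left _ _ ha
  obtain ⟨h', h1, h2, h3⟩ := H.extend V (fun i => Ideal.radical_mono (sup_le_sup_left
    (Ideal.span_mono Submodule.subset_span) _) (hrad i)) (n + 1 - c) (by omega)
  rw [Nat.add_sub_cancel' hc] at h3
  let e' : ℕ → ℤ := fun j => if j < c then e j else δ
  have he' : ∀ i < n + 1, IsForm (h' i) (e' i) := by
    intro i _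
    by_cases hi : i < c
    · simp only [e', if_pos hi, h1 i hi]
      exact he i hi
    · simp only [e', if_neg hi]
      exact hVδ _ (h2 i (not_lt.1 hi))
  have hsum : ∑ j ∈ Finset.range (n + 1), e' j =
      ∑ j ∈ Finset.range c, e j + (n + 1 - c) * δ := by
    rw [← Finset.sum_range_add_sum_Ico e' hc]
    congr 1
    · exact Finset.sum_congr rfl fun j hj => if_pos (Finset.mem_range.1 hj)
    · rw [Finset.sum_congr rfl fun j hj => if_neg (not_lt.2 (Finset.mem_Ico.1 hj).1),
        Finset.sum_const, Nat.card_Ico, nsmul_eq_mul, Nat.cast_sub hc]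
      push_cast
      ring
  -- The class of `g / (x_0 ⋯ x_n) ^ L` is killed by the whole extended sequence, hence comes from
  -- `H^0` of the quotient by it.
  obtain ⟨η, hη, hval⟩ := exists_top_cochain (chain h' 0) (t := u - L * (n + 1)) (m := L) (g := g)
    (by rwa [sub_add_cancel])
  have htop := mk_smul_mem_coboundaries_top_iff (chain_zero h') hval
  obtain ⟨ω, hω, hiff⟩ := h3.exists_of_top he' le_rfl (q := 0) (zero_add _) hη fun j hj => by
    rw [htop]
    by_cases hjc : j < c
    · rw [h1 j hjc]
      exact hhg j hjc
    · exact hVg _ (h2 j (not_lt.1 hjc))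
  -- The connecting maps shift the degree `u - L (n + 1)` by `∑ e'`; by `hu` the result is negative.
  have hω0 : ω = 0 := eq_zero_of_mem_cochainDeg_zero (by rw [hsum]; linarith) hω
  have h4 := (htop 1).1 ((hiff 1).1 (by rw [hω0, smul_zero]; exact Submodule.zero_mem _))
  rwa [one_mul] at h4

end CI

/-! ### Reduction of the degree bound to an infinite field. -/

namespace CI

open Cech

variable {k : Type*} [Field k] {n : ℕ}

/-- A finite family continued by `0`. -/
def finSeq {c : ℕ} (f : Fin c → MvPolynomial (Fin (n + 1)) k) (i : ℕ) :
    MvPolynomial (Fin (n + 1)) k :=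
  if h : i < c then f ⟨i, h⟩ else 0

theorem finSeq_val {c : ℕ} (f : Fin c → MvPolynomial (Fin (n + 1)) k) (j : Fin c) :
    finSeq f j = f j := dif_pos j.2

theorem chain_finSeq_eq_ofList {c : ℕ} (f : Fin c → MvPolynomial (Fin (n + 1)) k) {i : ℕ}
    (hi : i ≤ c) : chain (finSeq f) i = Ideal.ofList ((List.ofFn f).take i) := by
  rw [chain, Ideal.ofList]
  congr 1
  ext a
  simp only [Set.mem_image, Set.mem_Iio, Set.mem_ofPred_eq, List.mem_take_iff_getElem,
    List.length_ofFn, List.getElem_ofFn]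
  constructor
  · rintro ⟨j, hj, rfl⟩
    exact ⟨j, by omega, by rw [finSeq, dif_pos]⟩
  · rintro ⟨j, hj, rfl⟩
    exact ⟨j, by omega, by rw [finSeq, dif_pos]⟩

theorem chain_finSeq {c : ℕ} (f : Fin c → MvPolynomial (Fin (n + 1)) k) :
    chain (finSeq f) c = Ideal.span (Set.range f) := by
  rw [chain]
  congr 1
  ext a
  constructor
  · rintro ⟨j, hj, rfl⟩
    exact ⟨⟨j, hj⟩, (finSeq_val f ⟨j, hj⟩).symm⟩
  · rintro ⟨j, rfl⟩
    exact ⟨j, j.2, finSeq_val f j⟩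

theorem regularChain_finSeq {c : ℕ} {f : Fin c → MvPolynomial (Fin (n + 1)) k}
    (h : RingTheory.Sequence.IsWeaklyRegular (MvPolynomial (Fin (n + 1)) k) (List.ofFn f)) :
    RegularChain (finSeq f) c := by
  intro i hi s hs
  have h1 := h.regular_mod_prev i (by simpa using hi)
  rw [isSMulRegular_quotient_iff_mem_of_smul_mem] at h1
  have h2 := h1 s
  simp only [smul_eq_mul, Ideal.mul_top, List.getElem_ofFn] at h2
  rw [chain_finSeq_eq_ofList f hi.le] at hs ⊢
  rw [finSeq, dif_pos hi] at hs
  exact h2 hs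

section BaseChange

variable (K : Type*) [Field K] [Algebra k K]

/-- Extension of scalars of polynomials. -/
abbrev extend : MvPolynomial (Fin (n + 1)) k →+* MvPolynomial (Fin (n + 1)) K :=
  MvPolynomial.map (algebraMap k K)

/-- `K[x]` is flat over `k[x]`, as the base change of a field extension. -/
theorem isWeaklyRegular_extend {c : ℕ} {f : Fin c → MvPolynomial (Fin (n + 1)) k}
    (h : RingTheory.Sequence.IsWeaklyRegular (MvPolynomial (Fin (n + 1)) k) (List.ofFn f)) :
    RingTheory.Sequence.IsWeaklyRegular (MvPolynomial (Fin (n + 1)) K)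
      (List.ofFn fun j => extend K (f j)) := by
  let : Algebra (MvPolynomial (Fin (n + 1)) k) (MvPolynomial (Fin (n + 1)) K) :=
    MvPolynomial.algebraMvPolynomial
  have h1 : Module.Flat (MvPolynomial (Fin (n + 1)) k) (MvPolynomial (Fin (n + 1)) K) :=
    Module.Flat.isBaseChange k (MvPolynomial (Fin (n + 1)) k) K _
      (Algebra.IsPushout.out (R := k) (S := MvPolynomial (Fin (n + 1)) k) (R' := K)
        (S' := MvPolynomial (Fin (n + 1)) K))
  have h2 := h.of_flat (S := MvPolynomial (Fin (n + 1)) K)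
  rwa [List.map_ofFn] at h2

theorem isForm_extend {a : MvPolynomial (Fin (n + 1)) k} {t : ℤ} (h : IsForm a t) :
    IsForm (extend K a) t := by
  rw [isForm_iff] at h ⊢
  intro m hm
  refine h m fun h0 => hm ?_
  rw [MvPolynomial.coeff_map, h0, map_zero]

theorem extend_mem_powIdeal_iff {a : MvPolynomial (Fin (n + 1)) k} {m : ℕ} :
    extend K a ∈ powIdeal K n m ↔ a ∈ powIdeal k n m := by
  rw [mem_powIdeal, mem_powIdeal,
    MvPolynomial.support_map_of_injective a (algebraMap k K).injective]

end BaseChange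

/-- The hypotheses pass to the algebraic closure, which is infinite, and the conclusion descends
because membership in `powIdeal` depends only on the support. -/
theorem mem_powIdeal_of_mul_mem {c : ℕ} {f : Fin c → MvPolynomial (Fin (n + 1)) k}
    (hreg : RingTheory.Sequence.IsWeaklyRegular (MvPolynomial (Fin (n + 1)) k) (List.ofFn f))
    (hc : c ≤ n + 1) {deg : Fin c → ℤ} (hf : ∀ j, IsForm (f j) (deg j))
    {M : Set (MvPolynomial (Fin (n + 1)) k)} {δ : ℤ} (hM : ∀ a ∈ M, IsForm a δ)
    (hrad : ∀ i, MvPolynomial.X i ∈ (Ideal.span (Set.range f) ⊔ Ideal.span M).radical)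
    {L : ℕ} {u : ℤ} {g : MvPolynomial (Fin (n + 1)) k} (hg : IsForm g u)
    (hu : u + ∑ j, deg j + (n + 1 - c) * δ < L * (n + 1))
    (hfg : ∀ j, f j * g ∈ powIdeal k n L) (hMg : ∀ a ∈ M, a * g ∈ powIdeal k n L) :
    g ∈ powIdeal k n L := by
  let K := AlgebraicClosure k
  rw [← extend_mem_powIdeal_iff K]
  let e : ℕ → ℤ := fun i => if h : i < c then deg ⟨i, h⟩ else 0
  refine (regularChain_finSeq (isWeaklyRegular_extend K hreg)).mem_powIdeal_of_infinite hc (e := e)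
    (M := extend K '' M) (δ := δ) ?_ ?_ ?_ (isForm_extend K hg) ?_ ?_ ?_
  · intro i hi
    simp only [finSeq, e, dif_pos hi]
    exact isForm_extend K (hf _)
  · rintro _ ⟨a, ha, rfl⟩
    exact isForm_extend K (hM a ha)
  · intro i
    obtain ⟨r, hr⟩ := hrad i
    refine ⟨r, ?_⟩
    have h1 := Ideal.mem_map_of_mem (extend K) hr
    rw [Ideal.map_sup, Ideal.map_span, Ideal.map_span, map_pow, MvPolynomial.map_X,
      ← Set.range_comp] at h1
    rw [chain_finSeq]
    exact h1
  · have h1 : ∑ j ∈ Finset.range c, e j = ∑ j, deg j := by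
      rw [← Fin.sum_univ_eq_sum_range]
      exact Finset.sum_congr rfl fun j _ => dif_pos j.2
    rwa [h1]
  · intro i hi
    rw [finSeq, dif_pos hi, ← map_mul, extend_mem_powIdeal_iff]
    exact hfg _
  · rintro _ ⟨a, ha, rfl⟩
    rw [← map_mul, extend_mem_powIdeal_iff]
    exact hMg a ha

/-! ### Frobenius, derivations and minors of the Jacobian matrix. -/

section Frobenius

variable {p : ℕ} [hp : Fact p.Prime] [CharP k p]

theorem pow_mem_powIdeal {m : ℕ} {a : MvPolynomial (Fin (n + 1)) k} (h : a ∈ powIdeal k n m) :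
    a ^ p ∈ powIdeal k n (m * p) := by
  obtain ⟨b, rfl⟩ := Ideal.mem_span_range_iff_exists_fun.1 h
  rw [sum_pow_char]
  refine Ideal.sum_mem _ fun i _ => ?_
  rw [mul_pow, ← pow_mul]
  exact Ideal.mul_mem_left _ _ (Ideal.subset_span ⟨i, rfl⟩)

/-- The coefficient of `a ^ p` at `p • μ` is the `p`-th power of that of `a` at `μ`, so a monomial
of `a` outside the ideal would survive in `a ^ p`. -/
theorem mem_powIdeal_of_pow_mem {m : ℕ} {a : MvPolynomial (Fin (n + 1)) k}
    (h : a ^ p ∈ powIdeal k n (m * p)) : a ∈ powIdeal k n m := by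
  rw [mem_powIdeal] at h ⊢
  intro μ hμ
  obtain ⟨i, hi⟩ := h (p • μ) (by
    rw [MvPolynomial.mem_support_iff] at hμ ⊢
    rw [← MvPolynomial.map_frobenius_expand, MvPolynomial.coeff_map,
      MvPolynomial.coeff_expand_smul _ hp.out.ne_zero]
    exact pow_ne_zero p hμ)
  refine ⟨i, ?_⟩
  rw [Finsupp.smul_apply, smul_eq_mul, mul_comm] at hi
  exact Nat.le_of_mul_le_mul_left hi hp.out.pos

omit hp in
/-- Derivations preserve ideals generated by `p`-th powers. -/
theorem derivation_mem_powIdeal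
    (D : Derivation k (MvPolynomial (Fin (n + 1)) k) (MvPolynomial (Fin (n + 1)) k)) {m : ℕ}
    {a : MvPolynomial (Fin (n + 1)) k} (h : a ∈ powIdeal k n (m * p)) :
    D a ∈ powIdeal k n (m * p) := by
  obtain ⟨b, rfl⟩ := Ideal.mem_span_range_iff_exists_fun.1 h
  rw [map_sum]
  refine Ideal.sum_mem _ fun i _ => ?_
  rw [D.leibniz, pow_mul, D.leibniz_pow, ← pow_mul, ← Nat.cast_smul_eq_nsmul k,
    CharP.cast_eq_zero, zero_smul, smul_zero, zero_add, smul_eq_mul]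
  exact Ideal.mul_mem_right _ _ (Ideal.subset_span ⟨i, pow_mul _ _ _⟩)

omit hp in
theorem derivation_pow_char
    (D : Derivation k (MvPolynomial (Fin (n + 1)) k) (MvPolynomial (Fin (n + 1)) k))
    (a : MvPolynomial (Fin (n + 1)) k) : D (a ^ p) = 0 := by
  rw [D.leibniz_pow, ← Nat.cast_smul_eq_nsmul k, CharP.cast_eq_zero, zero_smul]

end Frobenius

theorem derivation_prod_eq_zero {ι : Type*}
    (D : Derivation k (MvPolynomial (Fin (n + 1)) k) (MvPolynomial (Fin (n + 1)) k))
    (s : Finset ι) (g : ι → MvPolynomial (Fin (n + 1)) k) (hg : ∀ i ∈ s, D (g i) = 0) :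
    D (∏ i ∈ s, g i) = 0 := by
  classical
  induction s using Finset.induction_on with
  | empty => simp
  | insert i s hi ih =>
    rw [Finset.prod_insert hi, D.leibniz, hg i (Finset.mem_insert_self i s),
      ih fun j hj => hg j (Finset.mem_insert_of_mem hj), smul_zero, smul_zero, add_zero]

/-- The matrix of the partial derivatives of `f` with respect to the variables `x_{r a}`. -/
def jacobianMatrix {c : ℕ} (f : Fin c → MvPolynomial (Fin (n + 1)) k) (r : Fin c ↪o Fin (n + 1)) :
    Matrix (Fin c) (Fin c) (MvPolynomial (Fin (n + 1)) k) :=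
  Matrix.of fun a j => MvPolynomial.pderiv (r a) (f j)

/-- The derivations dual to `f` up to a minor of the Jacobian matrix. -/
theorem exists_derivation {c : ℕ} (f : Fin c → MvPolynomial (Fin (n + 1)) k)
    (r : Fin c ↪o Fin (n + 1)) (l : Fin c) :
    ∃ D : Derivation k (MvPolynomial (Fin (n + 1)) k) (MvPolynomial (Fin (n + 1)) k),
      D (f l) = (jacobianMatrix f r).det ∧ ∀ j, j ≠ l → D (f j) = 0 := by
  have h1 : ∀ j, (∑ a, (jacobianMatrix f r).adjugate l a • MvPolynomial.pderiv (R := k) (r a)) (f j) =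
      ((jacobianMatrix f r).adjugate * jacobianMatrix f r) l j := by
    intro j
    have h2 := congrFun (map_sum (Derivation.coeFnAddMonoidHom (R := k)
      (A := MvPolynomial (Fin (n + 1)) k) (M := MvPolynomial (Fin (n + 1)) k))
      (fun a => (jacobianMatrix f r).adjugate l a • MvPolynomial.pderiv (R := k) (r a))
      Finset.univ) (f j)
    rw [Finset.sum_apply] at h2
    rw [Matrix.mul_apply]
    exact h2
  -- Cramer's rule: the coefficients are row `l` of the adjugate.
  refine ⟨∑ a, (jacobianMatrix f r).adjugate l a • MvPolynomial.pderiv (r a), ?_, fun j hj => ?_⟩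
  · rw [h1, Matrix.adjugate_mul]
    simp
  · rw [h1, Matrix.adjugate_mul]
    simp [Matrix.one_apply_ne hj.symm]

/-- Column `j` has entries of degree `deg j - 1`, so every term of the determinant has the same
degree. The value does not depend on `r`, so linear combinations of minors are again forms. -/
theorem isForm_det_jacobianMatrix {c : ℕ} {f : Fin c → MvPolynomial (Fin (n + 1)) k}
    {deg : Fin c → ℕ} (hf : ∀ j, (f j).IsHomogeneous (deg j)) (hdeg : ∀ j, 1 ≤ deg j)
    (r : Fin c ↪o Fin (n + 1)) :
    IsForm (jacobianMatrix f r).det ((∑ j, (deg j : ℤ)) - c) := by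
  rw [Matrix.det_apply]
  refine (MvPolynomial.weightedHomogeneousSubmodule k _ _).sum_mem fun σ _ => ?_
  have h1 : IsForm (∏ j, jacobianMatrix f r (σ j) j) ((∑ j, (deg j : ℤ)) - c) := by
    have h2 := MvPolynomial.IsWeightedHomogeneous.prod Finset.univ
      (fun j => jacobianMatrix f r (σ j) j) (fun j => (deg j : ℤ) - 1) (w := fun _ => (1 : ℤ))
      (fun j _ => by
        have h3 := IsForm.of_isHomogeneous ((hf j).pderiv (i := r (σ j)))
        rwa [Nat.cast_sub (hdeg j), Nat.cast_one] at h3)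
    simpa using h2
  rcases Int.units_eq_one_or (Equiv.Perm.sign σ) with h | h <;> rw [h]
  · rw [one_smul]
    exact h1
  · rw [Units.neg_smul, one_smul]
    exact (MvPolynomial.weightedHomogeneousSubmodule k _ _).neg_mem h1

end CI

/-! ### The descent on exponents and injectivity of Frobenius. -/

namespace CI

open Cech

variable {k : Type*} [Field k] {n : ℕ} {p : ℕ} [hp : Fact p.Prime] [CharP k p] {c : ℕ}
  {f : Fin c → MvPolynomial (Fin (n + 1)) k} {deg : Fin c → ℕ}

theorem jacobianIdeal_eq_span (f : Fin c → MvPolynomial (Fin (n + 1)) k) :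
    jacobianIdeal f = Ideal.span (Set.range fun r => (jacobianMatrix f r).det) := rfl

/-- A form of degree `0` is a constant. A nonzero constant generates the unit ideal, and `0` is
regular only modulo the unit ideal; both contradict properness of `(f)`. -/
theorem one_le_deg (hf : ∀ j, (f j).IsHomogeneous (deg j))
    (hreg : RingTheory.Sequence.IsRegular (MvPolynomial (Fin (n + 1)) k) (List.ofFn f))
    (j : Fin c) : 1 ≤ deg j := by
  have htop : (1 : MvPolynomial (Fin (n + 1)) k) ∉ chain (finSeq f) c := by
    rw [chain_finSeq_eq_ofList f le_rfl, List.take_of_length_le (by simp), ← Ideal.eq_top_iff_one]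
    have h1 := hreg.top_ne_smul
    rw [smul_eq_mul, Ideal.mul_top] at h1
    exact h1.symm
  by_contra h0
  have h1 : (f j).IsHomogeneous 0 := by
    rw [show 0 = deg j by omega]
    exact hf j
  rw [← MvPolynomial.totalDegree_zero_iff_isHomogeneous,
    MvPolynomial.totalDegree_eq_zero_iff_eq_C] at h1
  have hmem : f j ∈ chain (finSeq f) c := finSeq_val f j ▸ mem_chain (finSeq f) j.2
  by_cases hb : (f j).coeff 0 = 0
  · rw [hb, map_zero] at h1
    have h2 := regularChain_finSeq hreg.toIsWeaklyRegular j.1 j.2 1 (by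
      rw [finSeq_val, h1, zero_mul]
      exact Ideal.zero_mem _)
    exact htop (Ideal.span_mono (Set.image_mono (Set.Iio_subset_Iio j.2.le)) h2)
  · refine htop ?_
    rw [h1] at hmem
    have h2 := Ideal.mul_mem_left _ (MvPolynomial.C ((f j).coeff 0)⁻¹) hmem
    rwa [← map_mul, inv_mul_cancel₀ hb, map_one] at h2

theorem prod_pow_update (f : Fin c → MvPolynomial (Fin (n + 1)) k) (b : Fin c → ℕ) (l : Fin c) :
    ∏ j, f j ^ Function.update b l (b l + 1) j = f l * ∏ j, f j ^ b j := by
  rw [← Finset.mul_prod_erase Finset.univ _ (Finset.mem_univ l),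
    ← Finset.mul_prod_erase Finset.univ (fun j => f j ^ b j) (Finset.mem_univ l),
    Function.update_self, pow_succ', mul_assoc]
  congr 2
  exact Finset.prod_congr rfl fun j hj => by rw [Function.update_of_ne (Finset.ne_of_mem_erase hj)]

theorem sum_update_succ (b : Fin c → ℕ) (l : Fin c) :
    ∑ j, Function.update b l (b l + 1) j = ∑ j, b j + 1 := by
  rw [← Finset.add_sum_erase Finset.univ _ (Finset.mem_univ l),
    ← Finset.add_sum_erase Finset.univ b (Finset.mem_univ l), Function.update_self,
    Finset.sum_congr rfl fun j hj => Function.update_of_ne (Finset.ne_of_mem_erase hj) (b l + 1) b]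
  exact add_right_comm _ _ _

omit hp in
/-- Differentiating along a derivation dual to `f l` lowers the exponent of `f l` at the cost of a
minor of the Jacobian matrix. -/
theorem det_mul_mem_powIdeal (r : Fin c ↪o Fin (n + 1)) (b : Fin c → ℕ) (l : Fin c)
    (hl : b l + 1 < p) {m : ℕ} (a : MvPolynomial (Fin (n + 1)) k)
    (h : f l * (∏ j, f j ^ b j) * a ^ p ∈ powIdeal k n (m * p)) :
    (jacobianMatrix f r).det * ((∏ j, f j ^ b j) * a ^ p) ∈ powIdeal k n (m * p) := by
  obtain ⟨D, hDl, hD⟩ := exists_derivation f r l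
  have h1 := derivation_mem_powIdeal D h
  -- `D` sees only the power of `f l`: it kills the other `f j` and all `p`-th powers.
  have h2 : D ((∏ j ∈ Finset.univ.erase l, f j ^ b j) * a ^ p) = 0 := by
    rw [D.leibniz, derivation_pow_char, smul_zero, zero_add,
      derivation_prod_eq_zero D _ _ fun j hj => ?_, smul_zero]
    rw [D.leibniz_pow, hD j (Finset.ne_of_mem_erase hj), smul_zero, smul_zero]
  have h3 : f l * (∏ j, f j ^ b j) * a ^ p =
      f l ^ (b l + 1) * ((∏ j ∈ Finset.univ.erase l, f j ^ b j) * a ^ p) := by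
    rw [← Finset.mul_prod_erase Finset.univ _ (Finset.mem_univ l)]
    ring
  -- The factor `b l + 1` from differentiating lies strictly between `0` and `p`, hence is
  -- invertible in `k`.
  have hne : ((b l + 1 : ℕ) : k) ≠ 0 := by
    rw [Ne, CharP.cast_eq_zero_iff k p]
    exact fun hdvd => absurd (Nat.le_of_dvd (Nat.succ_pos _) hdvd) (not_le.2 hl)
  rw [h3, D.leibniz, h2, smul_zero, zero_add, D.leibniz_pow, hDl, Nat.add_sub_cancel,
    ← Nat.cast_smul_eq_nsmul k, smul_comm] at h1
  have h4 := Submodule.smul_of_tower_mem (powIdeal k n (m * p)) (((b l + 1 : ℕ) : k)⁻¹) h1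
  rw [smul_smul, inv_mul_cancel₀ hne, one_smul, smul_eq_mul, smul_eq_mul] at h4
  have h5 : (jacobianMatrix f r).det * ((∏ j, f j ^ b j) * a ^ p) =
      (∏ j ∈ Finset.univ.erase l, f j ^ b j) * a ^ p *
        (f l ^ b l * (jacobianMatrix f r).det) := by
    rw [← Finset.mul_prod_erase Finset.univ (fun j => f j ^ b j) (Finset.mem_univ l)]
    ring
  rw [h5]
  exact h4

/-- A class in the top local cohomology of the polynomial ring, with numerator `a`, that is killed
by `f` and whose Frobenius image is killed by `(∏ f) ^ (p - 1)` vanishes in small degrees. -/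
theorem mem_powIdeal_of_frobenius (hf : ∀ j, (f j).IsHomogeneous (deg j))
    (hreg : RingTheory.Sequence.IsRegular (MvPolynomial (Fin (n + 1)) k) (List.ofFn f))
    (hsing : (jacobianIdeal f ⊔ Ideal.span (Set.range f)).radical =
      Ideal.span (Set.range MvPolynomial.X))
    (hc : c ≤ n + 1)
    (hple : ((n : ℤ) + 1 - c) * ((∑ j, (deg j : ℤ)) - c) ≤ p)
    {m : ℕ} {v : ℤ} {a : MvPolynomial (Fin (n + 1)) k} (ha : IsForm a v)
    (hv : v + ∑ j, (deg j : ℤ) < m * (n + 1)) (hfa : ∀ j, f j * a ∈ powIdeal k n m)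
    (hfrob : (∏ j, f j) ^ (p - 1) * a ^ p ∈ powIdeal k n (m * p)) : a ∈ powIdeal k n m := by
  have hp1 : 1 ≤ p := hp.out.one_le
  have hdeg := one_le_deg hf hreg
  -- Once an exponent reaches `p`, the product contains `(f j * a) ^ p`, which lies in the ideal by
  -- `hfa`.
  have hbig : ∀ (b : Fin c → ℕ) (j : Fin c), p ≤ b j →
      (∏ j, f j ^ b j) * a ^ p ∈ powIdeal k n (m * p) := by
    intro b j hj
    have h1 := pow_mem_powIdeal (p := p) (hfa j)
    rw [← Finset.mul_prod_erase Finset.univ _ (Finset.mem_univ j),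
      ← Nat.sub_add_cancel hj, pow_add]
    have h2 : f j ^ (b j - p) * f j ^ p * (∏ i ∈ Finset.univ.erase j, f i ^ b i) * a ^ p =
        f j ^ (b j - p) * (∏ i ∈ Finset.univ.erase j, f i ^ b i) * (f j * a) ^ p := by
      ring
    rw [h2]
    exact Ideal.mul_mem_left _ _ h1
  -- Descent on `∑ b`, with `r` bounding its distance below `c (p - 1)`. At distance `0`, either
  -- some exponent is at least `p` or all equal `p - 1`, the case given by `hfrob`.
  have key : ∀ (r : ℕ) (b : Fin c → ℕ), c * (p - 1) ≤ ∑ j, b j + r →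
      (∏ j, f j ^ b j) * a ^ p ∈ powIdeal k n (m * p) := by
    intro r
    induction r with
    | zero =>
      intro b hb
      by_cases h1 : ∃ j, p ≤ b j
      · obtain ⟨j, hj⟩ := h1
        exact hbig b j hj
      push Not at h1
      have h2 : ∀ j ∈ Finset.univ, b j = p - 1 := by
        refine (Finset.sum_eq_sum_iff_of_le fun j _ => Nat.le_sub_one_of_lt (h1 j)).1 ?_
        refine le_antisymm (Finset.sum_le_sum fun j _ => Nat.le_sub_one_of_lt (h1 j)) ?_
        simpa using hb
      rw [Finset.prod_congr rfl fun j hj => by rw [h2 j hj], Finset.prod_pow]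
      exact hfrob
    | succ r ih =>
      intro b hb
      by_cases h0 : c * (p - 1) ≤ ∑ j, b j + r
      · exact ih b h0
      by_cases h1 : ∃ j, p ≤ b j
      · obtain ⟨j, hj⟩ := h1
        exact hbig b j hj
      push Not at h1
      -- Since `∑ b < c (p - 1)`, some exponent is less than `p - 1`. This `l` serves both the
      -- differentiation and the strict degree inequality.
      obtain ⟨l, hl⟩ : ∃ l, b l + 1 < p := by
        by_contra h2
        push Not at h2
        have h3 : c * (p - 1) ≤ ∑ j, b j := by
          have h4 := Finset.sum_le_sum (s := Finset.univ) (f := fun _ : Fin c => p - 1) (g := b)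
            fun j _ => Nat.sub_le_iff_le_add.2 (h2 j)
          simpa using h4
        omega
      have hup : ∀ j, f j * (∏ j, f j ^ b j) * a ^ p ∈ powIdeal k n (m * p) := by
        intro j
        rw [← prod_pow_update]
        exact ih _ (by rw [sum_update_succ]; omega)
      have hform : IsForm ((∏ j, f j ^ b j) * a ^ p) (∑ j, (b j : ℤ) * deg j + p * v) := by
        have h2 := MvPolynomial.IsWeightedHomogeneous.prod Finset.univ
          (fun j => f j ^ b j) (fun j => b j • (deg j : ℤ)) (w := fun _ => (1 : ℤ))
          fun j _ => (IsForm.of_isHomogeneous (hf j)).pow (b j)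
        have h3 := h2.mul (ha.pow p)
        simpa only [nsmul_eq_mul] using h3
      refine mem_powIdeal_of_mul_mem hreg.toIsWeaklyRegular hc (deg := fun j => (deg j : ℤ))
        (fun j => IsForm.of_isHomogeneous (hf j))
        (M := Set.range fun r => (jacobianMatrix f r).det) (δ := (∑ j, (deg j : ℤ)) - c) ?_ ?_
        hform ?_ (fun j => by rw [← mul_assoc]; exact hup j) ?_
      · rintro _ ⟨r, rfl⟩
        exact isForm_det_jacobianMatrix hf hdeg r
      · intro i
        rw [sup_comm, ← jacobianIdeal_eq_span, hsing]
        exact Ideal.subset_span ⟨i, rfl⟩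
      -- Slack of at least `1` comes from `b l < p - 1` and `deg l ≥ 1`. Integrality of `hv` gives
      -- another `p`, which absorbs `(n + 1 - c)(d - c)` by `hple`, and the `1` makes the inequality
      -- strict.
      · have h2 : ∑ j, (b j : ℤ) * deg j + 1 ≤ (p - 1) * ∑ j, (deg j : ℤ) := by
          rw [Finset.mul_sum, ← Finset.add_sum_erase Finset.univ _ (Finset.mem_univ l),
            ← Finset.add_sum_erase Finset.univ (fun j => ((p : ℤ) - 1) * deg j)
              (Finset.mem_univ l)]
          have h3 : ∑ j ∈ Finset.univ.erase l, (b j : ℤ) * deg j ≤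
              ∑ j ∈ Finset.univ.erase l, ((p : ℤ) - 1) * deg j :=
            Finset.sum_le_sum fun j _ => by
              have := h1 j
              exact mul_le_mul_of_nonneg_right (by omega) (Int.natCast_nonneg _)
          have h4 : ((b l : ℤ) + 1) * deg l ≤ ((p : ℤ) - 1) * deg l :=
            mul_le_mul_of_nonneg_right (by omega) (Int.natCast_nonneg _)
          have h5 : (1 : ℤ) ≤ deg l := by exact_mod_cast hdeg l
          linarith
        have h6 : (p : ℤ) * (v + ∑ j, (deg j : ℤ) + 1) ≤ p * (m * (n + 1)) :=
          mul_le_mul_of_nonneg_left (by omega) (Int.natCast_nonneg _)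
        push_cast
        linarith
      · rintro _ ⟨r, rfl⟩
        exact det_mul_mem_powIdeal r b l hl a (hup l)
  -- At `b = 0` only `a ^ p` remains.
  have h1 := key (c * (p - 1)) 0 (by simp)
  simp only [Pi.zero_apply, pow_zero, Finset.prod_const_one, one_mul] at h1
  exact mem_powIdeal_of_pow_mem h1

theorem topValue_frob (J : Ideal (MvPolynomial (Fin (n + 1)) k)) (η : Cochain (vars J) (n + 1)) :
    topValue (frobCochain (vars J) p (natCast_quot J p) (n + 1) η) = topValue η ^ p := rfl

/-- Frobenius is injective on cocycles of a given negative degree modulo coboundaries. -/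
theorem mem_coboundaries_of_frob_mem (hf : ∀ j, (f j).IsHomogeneous (deg j))
    (hreg : RingTheory.Sequence.IsRegular (MvPolynomial (Fin (n + 1)) k) (List.ofFn f))
    (hsing : (jacobianIdeal f ⊔ Ideal.span (Set.range f)).radical =
      Ideal.span (Set.range MvPolynomial.X))
    (hc : c ≤ n + 1)
    (hple : ((n : ℤ) + 1 - c) * ((∑ j, (deg j : ℤ)) - c) ≤ p)
    {J : Ideal (MvPolynomial (Fin (n + 1)) k)} (hJ : J = chain (finSeq f) c)
    {t : ℤ} (ht : t < 0) {ω : Cochain (vars J) (n + 1 - c)}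
    (hω : d (vars J) (n + 1 - c) ω = 0) (hdeg : ω ∈ cochainDeg J (n + 1 - c) t)
    (hfrob : frobCochain (vars J) p (natCast_quot J p) (n + 1 - c) ω ∈
      coboundaries (vars J) (n + 1 - c)) : ω ∈ coboundaries (vars J) (n + 1 - c) := by
  subst hJ
  let e : ℕ → ℤ := fun i => if h : i < c then deg ⟨i, h⟩ else 0
  have he : ∀ i < c, IsForm (finSeq f i) (e i) := by
    intro i hi
    simp only [finSeq, e, dif_pos hi]
    exact IsForm.of_isHomogeneous (hf _)
  have hsum : ∑ j ∈ Finset.range c, e j = ∑ j, (deg j : ℤ) := by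
    rw [← Fin.sum_univ_eq_sum_range]
    exact Finset.sum_congr rfl fun j _ => dif_pos j.2
  have hprod : ∏ j ∈ Finset.range c, finSeq f j = ∏ j, f j := by
    rw [← Fin.prod_univ_eq_prod_range]
    exact Finset.prod_congr rfl fun j _ => finSeq_val f j
  obtain ⟨η, hηt, hη⟩ := (regularChain_finSeq hreg.toIsWeaklyRegular).exists_top he p le_rfl
    (by omega) hω hdeg
  rw [hprod] at hη
  rw [hsum] at hηt
  -- The numerator `a` has degree `t - d + m (n + 1)`, so `t < 0` is the degree hypothesis of
  -- `mem_powIdeal_of_frobenius`.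
  obtain ⟨m, a, ha, hval⟩ := mem_locDeg_iff.1 (mem_cochainDeg.1 hηt (topIndex n))
  rw [(topIndex n).2] at ha
  have h1 := mk_smul_mem_coboundaries_top_iff (chain_zero _) hval
  have hval' : topValue (frobCochain (vars (chain (finSeq f) 0)) p
      (natCast_quot (chain (finSeq f) 0) p) (n + 1) η) *
        toLoc (chain (finSeq f) 0) Finset.univ (∏ i, MvPolynomial.X i) ^ (m * p) =
      toLoc (chain (finSeq f) 0) Finset.univ (a ^ p) := by
    rw [topValue_frob, pow_mul, ← mul_pow, map_pow]
    exact congrArg (· ^ p) hval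
  have h2 := mk_smul_mem_coboundaries_top_iff (chain_zero _) hval'
  have hmem : a ∈ powIdeal k n m := by
    refine mem_powIdeal_of_frobenius hf hreg hsing hc hple ha ?_ (fun j => ?_) ?_
    · push_cast
      linarith
    · refine (h1 _).1 ((hη _).1.1 ?_)
      rw [mk_smul_of_mem (finSeq_val f j ▸ mem_chain (finSeq f) j.2)]
      exact Submodule.zero_mem _
    · have h3 := (h2 _).1 ((hη 1).2.1 (by rw [map_one, one_smul]; exact hfrob))
      rwa [one_mul] at h3
  have h4 := (hη 1).1.2 ((h1 1).2 (by rwa [one_mul]))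
  rwa [map_one, one_smul] at h4

theorem frob_mk (J : Ideal (MvPolynomial (Fin (n + 1)) k)) (q : ℕ) (ω : cocycles (vars J) q) :
    frob J p q (Submodule.Quotient.mk ω) =
      Submodule.Quotient.mk (frobCocycles (vars J) p (natCast_quot J p) q ω) := rfl

theorem mk_eq_zero_iff (J : Ideal (MvPolynomial (Fin (n + 1)) k)) (q : ℕ)
    (ω : cocycles (vars J) q) :
    (Submodule.Quotient.mk ω : H J q) = 0 ↔ ω.1 ∈ coboundaries (vars J) q := by
  rw [Submodule.Quotient.mk_eq_zero]
  exact Iff.rfl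

theorem frob_mem_negPart (J : Ideal (MvPolynomial (Fin (n + 1)) k)) (q : ℕ) {z : H J q}
    (hz : z ∈ negPart J q) : frob J p q z ∈ negPart J q := by
  have h1 : negPart J q ≤ (negPart J q).comap (frob J p q) := by
    refine iSup₂_le fun t ht => ?_
    rintro _ ⟨ω, hω, rfl⟩
    have hpt : (p : ℤ) * t < 0 :=
      mul_neg_of_pos_of_neg (by exact_mod_cast hp.out.pos) ht
    refine AddSubgroup.mem_iSup_of_mem (p * t) (AddSubgroup.mem_iSup_of_mem hpt ?_)
    exact ⟨frobCocycles (vars J) p (natCast_quot J p) q ω, frobCochain_mem_cochainDeg p hω, rfl⟩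
  exact h1 hz

/-- Classes of negative degree are represented by cocycles without components of nonnegative
degree. -/
theorem exists_cocycle_of_mem_negPart {J : Ideal (MvPolynomial (Fin (n + 1)) k)}
    (hJ : GeneratedByForms J) {q : ℕ} {z : H J q} (hz : z ∈ negPart J q) :
    ∃ ω : cocycles (vars J) q, (∀ t, 0 ≤ t → projCochain hJ q t ω.1 = 0) ∧
      Submodule.Quotient.mk ω = z := by
  -- Lacking components of nonnegative degree is a condition closed under sums, so it passes from
  -- the graded pieces to the subgroup they generate.
  let W : AddSubgroup (cocycles (vars J) q) :=
    ⨅ (t : ℤ) (_ : 0 ≤ t),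
      ((projCochain hJ q t).comp (cocycles (vars J) q).subtype.toAddMonoidHom).ker
  have h1 : negPart J q ≤ W.map (Submodule.mkQ _).toAddMonoidHom := by
    refine iSup₂_le fun t ht => AddSubgroup.map_mono fun ω hω => ?_
    simp only [W, AddSubgroup.mem_iInf, AddMonoidHom.mem_ker]
    exact fun t' ht' => projCochain_of_mem_ne hJ hω (by omega)
  obtain ⟨ω, hω, rfl⟩ := h1 hz
  simp only [W, SetLike.mem_coe, AddSubgroup.mem_iInf, AddMonoidHom.mem_ker] at hω
  exact ⟨ω, hω, rfl⟩

/-- A representing cocycle is the sum of its negative components. Projecting the coboundary `F ω` to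
degree `p * t` gives the Frobenius image of the degree `t` component, so each component is treated
separately. -/
theorem eq_zero_of_frob_eq_zero (hf : ∀ j, (f j).IsHomogeneous (deg j))
    (hreg : RingTheory.Sequence.IsRegular (MvPolynomial (Fin (n + 1)) k) (List.ofFn f))
    (hsing : (jacobianIdeal f ⊔ Ideal.span (Set.range f)).radical =
      Ideal.span (Set.range MvPolynomial.X))
    (hple : ((n : ℤ) + 1 - c) * ((∑ j, (deg j : ℤ)) - c) ≤ p)
    {z : H (Ideal.span (Set.range f)) (n + 1 - c)}
    (hz : z ∈ negPart (Ideal.span (Set.range f)) (n + 1 - c))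
    (h0 : frob (Ideal.span (Set.range f)) p (n + 1 - c) z = 0) : z = 0 := by
  have hJ : GeneratedByForms (Ideal.span (Set.range f)) := by
    refine ⟨_, rfl, ?_⟩
    rintro _ ⟨j, rfl⟩
    exact ⟨deg j, IsForm.of_isHomogeneous (hf j)⟩
  obtain ⟨ω, hω, rfl⟩ := exists_cocycle_of_mem_negPart hJ hz
  rw [frob_mk, mk_eq_zero_iff] at h0
  rw [mk_eq_zero_iff]
  obtain ⟨s, hs⟩ := exists_sum_projCochain hJ _ ω.1
  rw [← hs]
  refine Submodule.sum_mem _ fun t _ => ?_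
  rcases le_or_gt 0 t with ht | ht
  · rw [hω t ht]
    exact Submodule.zero_mem _
  have hmem := projCochain_mem hJ _ t ω.1
  rcases le_or_gt c (n + 1) with hc | hc
  · refine mem_coboundaries_of_frob_mem (p := p) hf hreg hsing hc hple (chain_finSeq f).symm ht ?_
      hmem ?_
    · rw [← projCochain_d, show d _ _ ω.1 = 0 from ω.2, map_zero]
    · rw [← projCochain_frob]
      exact projCochain_mem_coboundaries hJ _ h0
  -- For `c > n + 1` the subtraction truncates to `0`, and cochains of degree `0` have no part of
  -- negative degree.
  · have hq : n + 1 - c = 0 := by omega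
    generalize n + 1 - c = q at ω hmem hq
    subst hq
    rw [eq_zero_of_mem_cochainDeg_zero ht hmem]
    exact Submodule.zero_mem _

end CI

end

theorem theorem3p5 (p : ℕ) [Fact p.Prime] (k : Type*) [Field k] [CharP k p]
    (hk : (frobenius k p).Finite) (n c : ℕ)
    (f : Fin c → MvPolynomial (Fin (n + 1)) k) (deg : Fin c → ℕ)
    (hf : ∀ j, (f j).IsHomogeneous (deg j))
    (hreg : RingTheory.Sequence.IsRegular (MvPolynomial (Fin (n + 1)) k) (List.ofFn f))
    (hsing : (CI.jacobianIdeal f ⊔ Ideal.span (Set.range f)).radical =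
      Ideal.span (Set.range MvPolynomial.X))
    (hp : ((n : ℤ) + 1 - c) * ((∑ j, (deg j : ℤ)) - c) ≤ p) :
    Set.MapsTo (CI.frob (Ideal.span (Set.range f)) p (n + 1 - c))
        (CI.negPart (Ideal.span (Set.range f)) (n + 1 - c))
        (CI.negPart (Ideal.span (Set.range f)) (n + 1 - c)) ∧
      Set.InjOn (CI.frob (Ideal.span (Set.range f)) p (n + 1 - c))
        (CI.negPart (Ideal.span (Set.range f)) (n + 1 - c)) := by
  refine ⟨fun z hz => CI.frob_mem_negPart _ _ hz, fun z hz w hw hzw => ?_⟩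
  rw [← sub_eq_zero]
  refine CI.eq_zero_of_frob_eq_zero (p := p) hf hreg hsing hp
    (AddSubgroup.sub_mem _ hz hw) ?_
  rw [map_sub, hzw, sub_self]
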